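/- **Setting.** Let $A\in\mathbb Z^{m\times n}$ ($m\ge 1$), $b\in\mathbb Z^m$, $c\in\mathbb Z^n$ be the data of the integer program $\min\{c^\top x: Ax=b,\ x\in\mathbb Z^n_{\ge 0}\}$, let $L$ be its binary input length, and let $\mathcal B\subset[n]$, $|\mathcal B|=m$, be an optimal basis of its LP relaxation, $\mathcal N=[n]\setminus\mathcal B$. The group relaxation is $\min\{c^\top x: Ax=b,\ x_{\mathcal B}\in\mathbb Z^m,\ x_{\mathcal N}\in\mathbb Z_{\ge0}^{n-m}\}$. Let $A_{\mathcal B}=URV$ be a Smith normal form, $R=\mathrm{diag}(r_1,\dots,r_m)$, $r_i>0$, $r_1\mid\dots\mid r_m$. Let $\mathbf A\in\mathbb Z^{m\times d}$ consist of the columns of $U^{-1}A_{\mathcal N}$ not in $R\mathbb Z^m$ (the dropped variables are set to $0$), let $\mathbf b=U^{-1}b$, and let $\mathbf c\ge 0$ be the corresponding reduced costs. Put $Z=\mathbb Z_{r_m}^d$, $K=\{x\in Z:\mathbf Ax=0 \pmod{R\mathbb Z^m}\}$, and suppose $\hat x\in Z$ is given with $\mathbf A\hat x=\mathbf b\pmod{R\mathbb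 Z^m}$. For $x\in K$ let $f(x)=\mathbf c^\top(\hat x+x \bmod r_m)+c_{\mathcal B}^\top A_{\mathcal B}^{-1}b$, let $K^\star\subseteq K$ be the set of minimizers of $f$, and $\pi^\star=|K^\star|/|K|$. Let $h_1,\dots,h_k\in K$, $k\le d$, be such that $K$ is the direct sum of the cyclic groups $\langle h_1\rangle,\dots,\langle h_k\rangle$. The product-of-cycles Cayley walk on $K$ picks $j\in[k]$ uniformly and adds $h_j$ or $-h_j$ with probability $1/2$ each; let $P$ be its transition matrix or that of its lazy variant, $\frac12(I+\text{walk})$. Let $t_{\mathrm{mix}}(\delta)$ be the least $t$ for which, from every initial distribution, the law after $t$ steps of $P$ is within total variation distance $\delta$ of the uniform distribution on $K$ ($\infty$ if there is none). **Markov chain search** with failure probability $\epsilon\in(0,1)$: start with $z=\hat x$; for $i=0,1,\dots$ while $i\le\frac{2}{\pi^\star}\log(1/\epsilon)$, run $t_{\mathrm{mix}}(\pi^\star/2)$ steps of the walk on the coset $\hat x+K$ from $z$ to obtain $\tilde z$, and replace $z$ by $\tilde z$ if the objective does not increase; output $z$. The inputs are $d,k,r_m$, the $h_j$, $\hat x$,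 the costs, the number of samples and $t_{\mathrm{mix}}(\pi^\star/2)$; runtime is the number of bit operations of this procedure on a random access machine with logarithmic cost and a primitive for uniform random integers. **Theorem.** 1. For every polynomial $p$ there is a polynomial $q$ such that for all data as above with $t_{\mathrm{mix}}(\pi^\star/2)\le p(n,L)$ and all $\epsilon\in(0,1)$: with probability at least $1-\epsilon$, Markov chain search outputs (the kept nonbasic coordinates of) an optimal solution of the group relaxation, and its runtime is always at most $$\frac{|K|}{|K^\star|}\cdot q(n,L)\cdot\bigl(1+\log(1/\epsilon)\bigr).$$ 2. The mixing prerequisite holds for the lazy walk when the cycles are short: there is a polynomial $s$ such that for all data as above (with $\hat x\in Z$ arbitrary) and every $u\in\mathbb N$ with $|\langle h_j\rangle|\le u$ for all $j$, the lazy walk satisfies $t_{\mathrm{mix}}(\pi^\star/2)\le s(n,L,u)$. -/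

import Mathlib

open Matrix

namespace MCS

/-! ### Integer programs, optimal LP bases, group relaxations -/

/-- Integer data of the program `min {cᵀ x : A x = b, x ≥ 0, x integral}`. -/
structure ILP (m n : ℕ) where
  A : Matrix (Fin m) (Fin n) ℤ
  b : Fin m → ℤ
  c : Fin n → ℤ

namespace ILP

variable {m n : ℕ} (P : ILP m n)

/-- Binary input length of the data; the entry `0` counts as one bit. -/
def inputLength : ℕ :=
  (∑ i, ∑ j, (1 + Nat.log 2 (P.A i j).natAbs)) + (∑ i, (1 + Nat.log 2 (P.b i).natAbs)) +
    ∑ j, (1 + Nat.log 2 (P.c j).natAbs)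

variable (B : Finset (Fin n)) (hB : B.card = m)

/-- The square matrix `A_B` of the columns indexed by `B`, in increasing order. -/
def basisMatrix : Matrix (Fin m) (Fin m) ℤ :=
  P.A.submatrix id (B.orderEmbOfFin hB)

/-- `A_B` over the rationals. -/
def basisMatrixQ : Matrix (Fin m) (Fin m) ℚ :=
  (P.basisMatrix B hB).map (Int.cast : ℤ → ℚ)

/-- The basic part `x_B = A_B⁻¹ b` of the basic primal solution. -/
noncomputable def primalB : Fin m → ℚ :=
  (P.basisMatrixQ B hB)⁻¹ *ᵥ (fun i => (P.b i : ℚ))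

/-- The cost vector `c_B`. -/
def costB : Fin m → ℤ := fun i => P.c (B.orderEmbOfFin hB i)

/-- The basic dual solution `y = (A_Bᵀ)⁻¹ c_B`. -/
noncomputable def dualB : Fin m → ℚ :=
  (fun i => (P.costB B hB i : ℚ)) ᵥ* (P.basisMatrixQ B hB)⁻¹

/-- The reduced cost `c_j - A_jᵀ y` of the index `j`. -/
noncomputable def reducedCost (j : Fin n) : ℚ :=
  (P.c j : ℚ) - P.dualB B hB ⬝ᵥ (fun i => (P.A i j : ℚ))

/-- `B` is an optimal basis of the LP relaxation: `A_B` is invertible, the basic primal and dual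
solutions are feasible, and complementary slackness holds. -/
structure IsOptimalBasis : Prop where
  det_ne_zero : (P.basisMatrix B hB).det ≠ 0
  primal_feasible : ∀ i, 0 ≤ P.primalB B hB i
  dual_feasible : ∀ j, 0 ≤ P.reducedCost B hB j
  compl_slack : ∀ i, P.primalB B hB i * P.reducedCost B hB (B.orderEmbOfFin hB i) = 0

/-- Feasible set of the group relaxation: nonnegativity is only required off the basis. -/
def groupFeasible : Set (Fin n → ℤ) :=
  {x | P.A *ᵥ x = P.b ∧ ∀ j, j ∉ B → 0 ≤ x j}

/-- Optimal solutions of the group relaxation `min {cᵀ x : x ∈ groupFeasible}`. -/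
def groupOptimal : Set (Fin n → ℤ) :=
  {x | x ∈ P.groupFeasible B ∧ ∀ y ∈ P.groupFeasible B, P.c ⬝ᵥ x ≤ P.c ⬝ᵥ y}

end ILP

/-- An integer program with at least one constraint, an optimal basis `B` of its LP relaxation and
a Smith normal form `A_B = U * diag r * V`. -/
structure GroupRelaxation (m n : ℕ) extends ILP m n where
  m_pos : 0 < m
  B : Finset (Fin n)
  card_B : B.card = m
  optimal : toILP.IsOptimalBasis B card_B
  U : Matrix (Fin m) (Fin m) ℤ
  V : Matrix (Fin m) (Fin m) ℤ
  r : Fin m → ℕ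
  U_unimodular : IsUnit U.det
  V_unimodular : IsUnit V.det
  r_pos : ∀ i, 0 < r i
  r_dvd : ∀ i j, i ≤ j → r i ∣ r j
  smith : toILP.basisMatrix B card_B = U * Matrix.diagonal (fun i => (r i : ℤ)) * V

namespace GroupRelaxation

variable {m n : ℕ} (I : GroupRelaxation m n)

/-- The last invariant factor `r_m`. -/
def rTop : ℕ := I.r ⟨m - 1, Nat.sub_lt I.m_pos Nat.one_pos⟩

instance : NeZero I.rTop := ⟨(I.r_pos _).ne'⟩

theorem r_dvd_rTop (i : Fin m) : I.r i ∣ I.rTop :=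
  I.r_dvd _ _ (Fin.le_def.2 (Nat.le_sub_one_of_lt i.2))

/-- The nonbasic indices `j` for which the column `U⁻¹ A_j` is not in `R ℤᵐ`. -/
noncomputable def keptCols : Finset (Fin n) := by
  classical
  exact Finset.univ.filter fun j =>
    j ∉ I.B ∧ ¬ ∀ i, (I.r i : ℤ) ∣ (I.U⁻¹ * I.A) i j

/-- Number of variables of the reduced group relaxation. -/
noncomputable def d : ℕ := I.keptCols.card

/-- The original index of the `l`-th variable of the reduced group relaxation. -/
noncomputable def col : Fin I.d ↪o Fin n := I.keptCols.orderEmbOfFin rfl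

/-- The coefficient matrix of the reduced group relaxation. -/
noncomputable def coeff : Matrix (Fin m) (Fin I.d) ℤ := (I.U⁻¹ * I.A).submatrix id I.col

/-- The right-hand side `U⁻¹ b`. -/
noncomputable def rhs : Fin m → ℤ := I.U⁻¹ *ᵥ I.b

/-- The cost vector of the reduced group relaxation (reduced costs of the kept columns). -/
noncomputable def cost (l : Fin I.d) : ℚ := I.reducedCost I.B I.card_B (I.col l)

/-- The constant `c_Bᵀ A_B⁻¹ b`. -/
noncomputable def shift : ℚ :=
  I.dualB I.B I.card_B ⬝ᵥ (fun i => (I.b i : ℚ))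

/-- The ambient group `(ℤ / r_m)^d`. -/
abbrev Z : Type := Fin I.d → ZMod I.rTop

/-- `x ↦ coeff * x` as a homomorphism from `(ℤ / r_m)^d` to `ℤᵐ / R ℤᵐ = ∏ i, ℤ / r_i`. -/
noncomputable def constraintHom : I.Z →+ (∀ i : Fin m, ZMod (I.r i)) where
  toFun x i := ∑ l, (I.coeff i l : ZMod (I.r i)) *
    ZMod.castHom (I.r_dvd_rTop i) (ZMod (I.r i)) (x l)
  map_zero' := by
    funext i
    simp
  map_add' x y := by
    funext i
    simp only [Pi.add_apply, map_add, mul_add, Finset.sum_add_distrib]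

/-- The null space `K`. -/
noncomputable def K : AddSubgroup I.Z := I.constraintHom.ker

noncomputable instance : Fintype I.K := Fintype.ofFinite _

/-- The residue vector `x` satisfies `coeff * x = rhs` modulo `R ℤᵐ`. -/
def IsFeasible (x : I.Z) : Prop := ∀ i, I.constraintHom x i = (I.rhs i : ZMod (I.r i))

/-- Objective value `cᵀ z + c_Bᵀ A_B⁻¹ b` of a residue vector, through its representative with
entries in `{0, …, r_m - 1}`. -/
noncomputable def value (z : I.Z) : ℚ := ∑ l, I.cost l * ((z l).val : ℚ) + I.shift

/-- The objective on the null space, relative to the feasible point `xhat`. -/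
noncomputable def f (xhat : I.Z) (x : I.K) : ℚ := I.value (xhat + (x : I.Z))

/-- The set `K*` of global minimizers of `f`. -/
def KStar (xhat : I.Z) : Set I.K := {x | ∀ y, I.f xhat x ≤ I.f xhat y}

/-- `π* = |K*| / |K|`, the probability that a uniform element of `K` is a global minimizer. -/
noncomputable def piStar (xhat : I.Z) : ℝ :=
  ((I.KStar xhat).ncard : ℝ) / (Nat.card I.K : ℝ)

/-- `v` lists the values of the variables `I.col l` in an optimal solution of the group relaxation
in which the nonbasic variables that were dropped are zero (the basic ones are then determined). -/
def Solves (v : Fin I.d → ℤ) : Prop :=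
  ∃ x ∈ I.groupOptimal I.B,
    (∀ l, x (I.col l) = v l) ∧ ∀ j, j ∉ I.B → j ∉ I.keptCols → x j = 0

/-- Integral costs, scaled by `|det A_B|`. -/
noncomputable def scaledCost (l : Fin I.d) : ℤ :=
  |(I.basisMatrix I.B I.card_B).det| * I.c (I.col l) -
    (I.basisMatrix I.B I.card_B).det.sign *
      ((I.costB I.B I.card_B ᵥ* (I.basisMatrix I.B I.card_B).adjugate) ⬝ᵥ fun i => I.A i (I.col l))

/-- Integral constant term, scaled by `|det A_B|`. -/
noncomputable def scaledShift : ℤ :=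
  (I.basisMatrix I.B I.card_B).det.sign *
    ((I.costB I.B I.card_B ᵥ* (I.basisMatrix I.B I.card_B).adjugate) ⬝ᵥ I.b)

/-- A list `h_1, …, h_k` (`k ≤ d`) in `K` such that `K` is the direct sum of the cyclic groups
`⟨h_1⟩, …, ⟨h_k⟩`. Trivial summands are allowed. -/
structure CyclicGenerators where
  k : ℕ
  k_le : k ≤ I.d
  h : Fin k → I.K
  directSum : Function.Bijective
    (fun a : (∀ j, AddSubgroup.zmultiples (h j)) => ∑ j, (a j : I.K))

variable {I}

/-- Transition matrix on `K` of the product-of-cycles Cayley walk: choose `j` uniformly, then add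
`h_j` or `-h_j` with probability `1/2` each. If there is no generator, the walk does not move. -/
noncomputable def CyclicGenerators.walk (S : I.CyclicGenerators) : Matrix I.K I.K ℝ :=
  if S.k = 0 then 1 else
    fun x y => ∑ j, ((1 : ℝ) / (2 * S.k)) *
      ((if y = x + S.h j then 1 else 0) + (if y = x - S.h j then 1 else 0))

/-- The Cayley walk `P`, or its lazy variant `(1 + P) / 2`. -/
noncomputable def CyclicGenerators.chain (S : I.CyclicGenerators) (isLazy : Bool) :
    Matrix I.K I.K ℝ :=
  if isLazy then (1 / 2 : ℝ) • (1 + S.walk) else S.walk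

end GroupRelaxation

/-! ### Mixing times -/

section Mixing

variable {α : Type*} [Fintype α] [DecidableEq α]

/-- Total variation distance. -/
noncomputable def tv (μ ν : α → ℝ) : ℝ := (1 / 2) * ∑ x, |μ x - ν x|

/-- Worst-case distance to `π` after `t` steps of the chain with transition matrix `P`. -/
noncomputable def distToStationary (P : Matrix α α ℝ) (π : α → ℝ) (t : ℕ) : ℝ :=
  ⨆ μ : stdSimplex ℝ α, tv ((μ : α → ℝ) ᵥ* (P ^ t)) π

/-- The mixing time, infinite if the distance `ε` is never reached. -/
noncomputable def mixingTime (P : Matrix α α ℝ) (π : α → ℝ) (ε : ℝ) : ℕ∞ :=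
  ⨅ t : {t : ℕ // distToStationary P π t ≤ ε}, ((t : ℕ) : ℕ∞)

/-- The uniform distribution. -/
noncomputable def uniform (α : Type*) [Fintype α] : α → ℝ := fun _ => 1 / (Fintype.card α : ℝ)

end Mixing

/-! ### A randomized random access machine with logarithmic cost -/

/-- Integer registers and integer arrays. -/
structure Mem where
  reg : ℕ → ℤ
  arr : ℕ → ℕ → ℤ

namespace Mem

def setReg (s : Mem) (x : ℕ) (v : ℤ) : Mem :=
  { s with reg := Function.update s.reg x v }

def setArr (s : Mem) (a i : ℕ) (v : ℤ) : Mem :=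
  { s with arr := Function.update s.arr a (Function.update (s.arr a) i v) }

end Mem

/-- Bit length of an integer, with one bit for the sign. -/
def bits (z : ℤ) : ℕ := Nat.size z.natAbs + 1

/-- Arithmetic expressions. -/
inductive AExp where
  | const (z : ℤ)
  | reg (x : ℕ)
  | get (a : ℕ) (i : AExp)
  | add (e₁ e₂ : AExp)
  | sub (e₁ e₂ : AExp)
  | mul (e₁ e₂ : AExp)
  | mod (e₁ e₂ : AExp)

namespace AExp

def eval (s : Mem) : AExp → ℤ
  | const z => z
  | reg x => s.reg x
  | get a i => s.arr a (i.eval s).toNat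
  | add e₁ e₂ => e₁.eval s + e₂.eval s
  | sub e₁ e₂ => e₁.eval s - e₂.eval s
  | mul e₁ e₂ => e₁.eval s * e₂.eval s
  | mod e₁ e₂ => e₁.eval s % e₂.eval s

/-- Bit cost of an evaluation: schoolbook arithmetic; an array access pays for the address and for
the entry that is read. -/
def cost (s : Mem) : AExp → ℕ
  | const z => bits z
  | reg x => bits (s.reg x)
  | get a i => i.cost s + bits (i.eval s) + bits (s.arr a (i.eval s).toNat)
  | add e₁ e₂ => e₁.cost s + e₂.cost s + bits (e₁.eval s) + bits (e₂.eval s)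
  | sub e₁ e₂ => e₁.cost s + e₂.cost s + bits (e₁.eval s) + bits (e₂.eval s)
  | mul e₁ e₂ => e₁.cost s + e₂.cost s + bits (e₁.eval s) * bits (e₂.eval s)
  | mod e₁ e₂ => e₁.cost s + e₂.cost s + bits (e₁.eval s) * bits (e₂.eval s)

end AExp

/-- Programs. -/
inductive Prog where
  /-- do nothing -/
  | skip
  /-- set register `x` to the value of `e` -/
  | assign (x : ℕ) (e : AExp)
  /-- set entry `i` of array `a` to the value of `e` -/
  | store (a : ℕ) (i e : AExp)
  /-- set register `x` to a uniformly random element of `{0, …, e - 1}` (to `0` if `e ≤ 0`) -/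
  | rand (x : ℕ) (e : AExp)
  | seq (p q : Prog)
  /-- run `p` if `e₁ ≤ e₂`, else `q` -/
  | ifLE (e₁ e₂ : AExp) (p q : Prog)
  /-- run `p` as often as the value of `e` on entry says -/
  | rep (e : AExp) (p : Prog)

/-- `N`-fold repetition, adding up costs, with one unit per round for the loop counter (a binary
counter runs through `N` values in `O(N)` bit operations). -/
noncomputable def loop (body : Mem → PMF (Mem × ℕ)) : ℕ → Mem → PMF (Mem × ℕ)
  | 0, s => PMF.pure (s, 0)
  | N + 1, s => (body s).bind fun o₁ => (loop body N o₁.1).bind fun o₂ =>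
      PMF.pure (o₂.1, o₁.2 + o₂.2 + 1)

/-- Joint law of the final memory and the number of bit operations. -/
noncomputable def Prog.run : Prog → Mem → PMF (Mem × ℕ)
  | .skip, s => PMF.pure (s, 1)
  | .assign x e, s => PMF.pure (s.setReg x (e.eval s), e.cost s + bits (e.eval s))
  | .store a i e, s => PMF.pure (s.setArr a (i.eval s).toNat (e.eval s),
      i.cost s + e.cost s + bits (i.eval s) + bits (e.eval s))
  | .rand x e, s => (PMF.uniformOfFintype (Fin ((e.eval s).toNat - 1 + 1))).bind fun v =>
      PMF.pure (s.setReg x ((v : ℕ) : ℤ), e.cost s + bits (e.eval s))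
  | .seq p q, s => (p.run s).bind fun o₁ => (q.run o₁.1).bind fun o₂ =>
      PMF.pure (o₂.1, o₁.2 + o₂.2)
  | .ifLE e₁ e₂ p q, s => (if e₁.eval s ≤ e₂.eval s then p.run s else q.run s).bind fun o =>
      PMF.pure (o.1, e₁.cost s + e₂.cost s + bits (e₁.eval s) + bits (e₂.eval s) + o.2)
  | .rep e p, s => (loop p.run (e.eval s).toNat s).bind fun o =>
      PMF.pure (o.1, e.cost s + bits (e.eval s) + o.2)

/-! ### Markov chain search as a program -/

namespace Search

/-! Input registers: dimension `d`, number `k` of generators, modulus `r_m`, number of samples,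
number of walk steps per sample, constant term of the objective. -/
abbrev dim : AExp := .reg 0
abbrev numGen : AExp := .reg 1
abbrev modulus : AExp := .reg 2
abbrev numSamples : AExp := .reg 3
abbrev numSteps : AExp := .reg 4
abbrev constTerm : AExp := .reg 5

/-! Work registers: running index, chosen generator, sign, laziness coin, two objective values. -/
abbrev idx : ℕ := 6
abbrev gen : ℕ := 7
abbrev sgn : ℕ := 8
abbrev coin : ℕ := 9
abbrev newVal : ℕ := 10
abbrev oldVal : ℕ := 11

/-! Arrays: current iterate `z`, position `w` of the walk, generators (entry `l` of generator `j` at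
position `j * d + l`), costs. -/
abbrev zArr : ℕ := 0
abbrev wArr : ℕ := 1
abbrev hArr : ℕ := 2
abbrev cArr : ℕ := 3

/-- Run `p` for the values `0, …, d - 1` of the running index. -/
def forIdx (p : Prog) : Prog :=
  .seq (.assign idx (.const 0))
    (.rep dim (.seq p (.assign idx (.add (.reg idx) (.const 1)))))

/-- Copy array `a` to array `b`. -/
def copyArr (a b : ℕ) : Prog := forIdx (.store b (.reg idx) (.get a (.reg idx)))

/-- Put the objective value of the vector in array `a` into register `x`. -/
def evalObj (a x : ℕ) : Prog :=
  .seq (.assign x constTerm)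
    (forIdx (.assign x (.add (.reg x) (.mul (.get cArr (.reg idx)) (.get a (.reg idx))))))

/-- One step of the Cayley walk. -/
def cayleyStep : Prog :=
  .seq (.rand gen numGen) <|
  .seq (.rand sgn (.const 2)) <|
  .seq (.assign sgn (.sub (.mul (.const 2) (.reg sgn)) (.const 1))) <|
  forIdx (.store wArr (.reg idx)
    (.mod (.add (.get wArr (.reg idx))
      (.mul (.reg sgn) (.get hArr (.add (.mul (.reg gen) dim) (.reg idx))))) modulus))

/-- One step of the Cayley walk or of its lazy variant. -/
def walkStep (isLazy : Bool) : Prog :=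
  if isLazy then
    .seq (.rand coin (.const 2)) (.ifLE (.reg coin) (.const 0) cayleyStep .skip)
  else cayleyStep

/-- Markov chain search: each round walks from the current iterate and moves the iterate to the
sample if the objective does not increase. -/
def mcs (isLazy : Bool) : Prog :=
  .rep numSamples <|
  .seq (copyArr zArr wArr) <|
  .seq (.rep numSteps (walkStep isLazy)) <|
  .seq (evalObj wArr newVal) <|
  .seq (evalObj zArr oldVal) <|
  .ifLE (.reg newVal) (.reg oldVal) (copyArr wArr zArr) .skip

end Search

namespace GroupRelaxation

variable {m n : ℕ} {I : GroupRelaxation m n}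

/-- The number of rounds of `i = 0; while i ≤ (2 / π*) log (1 / ε) do …; i ← i + 1`. -/
noncomputable def numSamples (xhat : I.Z) (ε : ℝ) : ℕ :=
  ⌊2 / I.piStar xhat * Real.log (1 / ε)⌋₊ + 1

/-- Mixing time of the chosen chain to within `π* / 2` of the uniform distribution on `K`. -/
noncomputable def tMix (S : I.CyclicGenerators) (xhat : I.Z) (isLazy : Bool) : ℕ∞ :=
  mixingTime (S.chain isLazy) (uniform I.K) (I.piStar xhat / 2)

/-- Initial memory: `d`, `k`, `r_m`, the number of samples, the mixing time, the constant term; the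
iterate `xhat`, the generators, the costs. All other cells are `0`. -/
noncomputable def initMem (S : I.CyclicGenerators) (xhat : I.Z) (isLazy : Bool) (ε : ℝ) :
    Mem where
  reg x :=
    if x = 0 then I.d
    else if x = 1 then S.k
    else if x = 2 then I.rTop
    else if x = 3 then numSamples xhat ε
    else if x = 4 then (tMix S xhat isLazy).toNat
    else if x = 5 then I.scaledShift
    else 0
  arr a p :=
    if a = Search.zArr then
      if hp : p < I.d then ((xhat ⟨p, hp⟩).val : ℤ) else 0
    else if a = Search.hArr then
      if hp : p / I.d < S.k ∧ p % I.d < I.d then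
        ((S.h ⟨p / I.d, hp.1⟩ : I.Z) ⟨p % I.d, hp.2⟩).val
      else 0
    else if a = Search.cArr then
      if hp : p < I.d then I.scaledCost ⟨p, hp⟩ else 0
    else 0

/-- Joint law of final memory and running time of Markov chain search. -/
noncomputable def search (S : I.CyclicGenerators) (xhat : I.Z) (isLazy : Bool) (ε : ℝ) :
    PMF (Mem × ℕ) :=
  (Search.mcs isLazy).run (initMem S xhat isLazy ε)

/-- The output vector: the first `d` entries of the array of the iterate. -/
noncomputable def output (I : GroupRelaxation m n) (s : Mem) : Fin I.d → ℤ :=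
  fun l => s.arr Search.zArr l

end GroupRelaxation

end MCS

/-!
# Markov chain search for the group relaxation

**Correctness.** A feasible residue vector extends to an integral solution of the group relaxation
(`exists_extension`), and reducing the nonbasic variables of a solution modulo `r_m` cannot increase
the objective, since reduced costs and nonbasic variables are nonnegative (`value_le_cost`). As the
feasible residue vectors are the coset `xhat + K`, minimizers of `f` on `K` give optimal solutions
(`solves_of_mem_KStar`).

**Success probability.** After the mixing time every sample lies in `K*` with probability at least
`π* - π* / 2`, wherever the walk started, and an iterate in `K*` stays in `K*`. Hence `N` rounds
fail with probability at most `(1 - π* / 2) ^ N ≤ exp (-N π* / 2)` (`le_iter_roundKernel`), which is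
at most `ε` for the number of rounds of the search.

**Runtime.** All numbers handled by the program are bounded by `magnitude`, whose bit length is
polynomial because the minors of `A` have polynomial bit length (`bits_magnitude_le`). So each round
costs at most a polynomial in `n`, `L` and the mixing time, and there are
`O ((|K| / |K*|) (1 + log (1 / ε)))` rounds.

Both facts about the program come from one simulation theorem (`mcs_simulates`): the law of its
memory and cost simulates the iterated kernel `roundKernel` on `K`, at a bounded cost. It is built
command by command from the rules for `Ensures` (deterministic parts) and `Simulates` (random
parts).

**Mixing of the lazy walk.** The characters of `K` diagonalize the walk. Eigenvalues are nonnegative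
by laziness, and a nontrivial character takes on some generator `h_j` a value `z ≠ 1` with
`z ^ N = 1` for some `N ≤ u`, so that its real part is at most `1 - 1 / (2 u²)`
(`re_le_of_pow_eq_one`). The spectral gap is therefore at least `1 / (4 k u²)`, and since
`|K| ≤ u ^ k`, the time `8 k² u³` suffices (`tMix_lazy_le`).
-/

open scoped ENNReal

namespace MCS

/-! ### Expectations under discrete laws -/

/-- Expectation of a nonnegative function under a discrete law. -/
noncomputable def expect {α : Type*} (μ : PMF α) (g : α → ℝ≥0∞) : ℝ≥0∞ := ∑' a, μ a * g a

theorem expect_pure {α : Type*} (a : α) (g : α → ℝ≥0∞) : expect (PMF.pure a) g = g a := by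
  unfold expect
  rw [tsum_eq_single a]
  · simp
  · intro b hb
    simp [PMF.pure_apply, hb]

theorem expect_bind {α β : Type*} (μ : PMF α) (k : α → PMF β) (g : β → ℝ≥0∞) :
    expect (μ.bind k) g = expect μ fun a => expect (k a) g := by
  unfold expect
  simp only [PMF.bind_apply, ← ENNReal.tsum_mul_right, ← ENNReal.tsum_mul_left]
  rw [ENNReal.tsum_comm]
  simp only [mul_assoc]

theorem expect_mono {α : Type*} (μ : PMF α) {g g' : α → ℝ≥0∞} (h : ∀ a ∈ μ.support, g a ≤ g' a) :
    expect μ g ≤ expect μ g' := by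
  refine ENNReal.tsum_le_tsum fun a => ?_
  by_cases ha : a ∈ μ.support
  · exact mul_le_mul_right (h a ha) _
  · rw [PMF.mem_support_iff, not_not] at ha
    simp [ha]

theorem expect_const {α : Type*} (μ : PMF α) (c : ℝ≥0∞) : expect μ (fun _ => c) = c := by
  unfold expect
  rw [ENNReal.tsum_mul_right, μ.tsum_coe, one_mul]

theorem expect_uniformOfFintype {α : Type*} [Fintype α] [Nonempty α] (g : α → ℝ≥0∞) :
    expect (PMF.uniformOfFintype α) g = ∑ a, (Fintype.card α : ℝ≥0∞)⁻¹ * g a := by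
  unfold expect
  rw [tsum_fintype]
  simp

theorem expect_indicator {α : Type*} (μ : PMF α) (s : Set α) :
    expect μ (s.indicator 1) = μ.toOuterMeasure s := by
  rw [PMF.toOuterMeasure_apply]
  unfold expect
  refine tsum_congr fun a => ?_
  by_cases h : a ∈ s <;> simp [h]

/-! ### Postconditions that hold surely, with a bound on the cost -/

/-- Every outcome of `μ` satisfies the postcondition `Q` and costs at most `C`. -/
def Ensures (μ : PMF (Mem × ℕ)) (C : ℕ) (Q : Mem → Prop) : Prop :=
  ∀ o ∈ μ.support, Q o.1 ∧ o.2 ≤ C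

namespace Ensures

theorem pure {s : Mem} {c C : ℕ} {Q : Mem → Prop} (hQ : Q s) (hc : c ≤ C) :
    Ensures (PMF.pure (s, c)) C Q := by
  intro o ho
  rw [PMF.support_pure, Set.mem_singleton_iff] at ho
  subst ho
  exact ⟨hQ, hc⟩

theorem mono {μ : PMF (Mem × ℕ)} {C C' : ℕ} {Q Q' : Mem → Prop} (h : Ensures μ C Q)
    (hC : C ≤ C') (hQ : ∀ s, Q s → Q' s) : Ensures μ C' Q' :=
  fun o ho => ⟨hQ _ (h o ho).1, (h o ho).2.trans hC⟩

theorem assign {s : Mem} {x : ℕ} {e : AExp} {C : ℕ} {Q : Mem → Prop}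
    (hQ : Q (s.setReg x (e.eval s))) (hC : e.cost s + bits (e.eval s) ≤ C) :
    Ensures ((Prog.assign x e).run s) C Q :=
  Ensures.pure hQ hC

theorem store {s : Mem} {a : ℕ} {i e : AExp} {C : ℕ} {Q : Mem → Prop}
    (hQ : Q (s.setArr a (i.eval s).toNat (e.eval s)))
    (hC : i.cost s + e.cost s + bits (i.eval s) + bits (e.eval s) ≤ C) :
    Ensures ((Prog.store a i e).run s) C Q :=
  Ensures.pure hQ hC

theorem seq {s : Mem} {p q : Prog} {C₁ C₂ : ℕ} {Q₁ Q₂ : Mem → Prop}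
    (hp : Ensures (p.run s) C₁ Q₁) (hq : ∀ s', Q₁ s' → Ensures (q.run s') C₂ Q₂) :
    Ensures ((Prog.seq p q).run s) (C₁ + C₂) Q₂ := by
  intro o ho
  simp only [Prog.run, PMF.mem_support_bind_iff, PMF.support_pure, Set.mem_singleton_iff] at ho
  obtain ⟨o₁, h₁, o₂, h₂, rfl⟩ := ho
  obtain ⟨hQ₁, hc₁⟩ := hp o₁ h₁
  obtain ⟨hQ₂, hc₂⟩ := hq _ hQ₁ o₂ h₂
  exact ⟨hQ₂, Nat.add_le_add hc₁ hc₂⟩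

theorem loop {body : Mem → PMF (Mem × ℕ)} {C : ℕ} (N : ℕ) (Inv : ℕ → Mem → Prop)
    (hbody : ∀ i < N, ∀ s, Inv i s → Ensures (body s) C (Inv (i + 1))) (s : Mem) (hs : Inv 0 s) :
    Ensures (loop body N s) (N * (C + 1)) (Inv N) := by
  induction N generalizing s Inv with
  | zero => exact Ensures.pure hs (by simp)
  | succ N ih =>
    intro o ho
    simp only [MCS.loop, PMF.mem_support_bind_iff, PMF.support_pure, Set.mem_singleton_iff] at ho
    obtain ⟨o₁, h₁, o₂, h₂, rfl⟩ := ho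
    obtain ⟨hQ₁, hc₁⟩ := hbody 0 (Nat.succ_pos _) s hs o₁ h₁
    obtain ⟨hQ₂, hc₂⟩ := ih (fun i => Inv (i + 1))
      (fun i hi s' h' => hbody (i + 1) (by omega) s' h') o₁.1 hQ₁ o₂ h₂
    refine ⟨hQ₂, ?_⟩
    rw [Nat.succ_mul]
    dsimp only
    omega

end Ensures

/-! ### Simulation of an abstract random process -/

/-- The law `μ` of memory and cost simulates an abstract random state: `Φ` is the expectation
functional of the abstract state, `R` relates abstract states to the memories representing them, and
`C` bounds the cost. The existence of a coupling supported on `R` is expressed through test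
functions (the easy direction of Strassen's theorem), in which form it composes without choices. -/
def Simulates {A : Type*} (μ : PMF (Mem × ℕ)) (C : ℕ) (R : A → Mem → Prop)
    (Φ : (A → ℝ≥0∞) → ℝ≥0∞) : Prop :=
  ∀ (h : A → ℝ≥0∞) (g : Mem × ℕ → ℝ≥0∞),
    (∀ a o, R a o.1 → o.2 ≤ C → h a ≤ g o) → Φ h ≤ expect μ g

theorem Ensures.simulates {A : Type*} {μ : PMF (Mem × ℕ)} {C : ℕ} {R : A → Mem → Prop} {a : A}
    (h : Ensures μ C (R a)) : Simulates μ C R (fun φ => φ a) := by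
  intro φ g hg
  calc φ a = expect μ (fun _ => φ a) := (expect_const _ _).symm
    _ ≤ expect μ g := expect_mono _ fun o ho => hg a o (h o ho).1 (h o ho).2

namespace Simulates

variable {A B : Type*}

theorem mono {μ : PMF (Mem × ℕ)} {C C' : ℕ} {R : A → Mem → Prop}
    {Φ Φ' : (A → ℝ≥0∞) → ℝ≥0∞} (h : Simulates μ C R Φ) (hC : C ≤ C') (hΦ : ∀ φ, Φ' φ ≤ Φ φ) :
    Simulates μ C' R Φ' :=
  fun φ g hg => (hΦ φ).trans (h φ g fun a o hR ho => hg a o hR (ho.trans hC))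

theorem seq {s : Mem} {p q : Prog} {C₁ C₂ : ℕ} {R₁ : A → Mem → Prop} {R₂ : B → Mem → Prop}
    {Φ : (A → ℝ≥0∞) → ℝ≥0∞} {Ψ : A → (B → ℝ≥0∞) → ℝ≥0∞}
    (hp : Simulates (p.run s) C₁ R₁ Φ)
    (hq : ∀ a s', R₁ a s' → Simulates (q.run s') C₂ R₂ (Ψ a)) :
    Simulates ((Prog.seq p q).run s) (C₁ + C₂) R₂ (fun φ => Φ fun a => Ψ a φ) := by
  intro φ g hg
  simp only [Prog.run, expect_bind, expect_pure]
  refine hp _ _ fun a o hR ho => ?_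
  exact hq a o.1 hR φ (fun o₂ => g (o₂.1, o.2 + o₂.2)) fun b o₂ hR₂ ho₂ =>
    hg b _ hR₂ (Nat.add_le_add ho ho₂)

/-- A deterministic first command only has to establish a relation that the second one uses. -/
theorem ensures_seq {s : Mem} {p q : Prog} {C₁ C₂ : ℕ} {Q : Mem → Prop} {R : B → Mem → Prop}
    {Ψ : (B → ℝ≥0∞) → ℝ≥0∞}
    (hp : Ensures (p.run s) C₁ Q)
    (hq : ∀ s', Q s' → Simulates (q.run s') C₂ R Ψ) :
    Simulates ((Prog.seq p q).run s) (C₁ + C₂) R Ψ :=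
  seq (A := Unit) (R₁ := fun _ => Q) (Ψ := fun _ => Ψ) (hp.simulates (a := ()))
    fun _ s' h => hq s' h

/-- `N`-fold iteration of a kernel of expectation functionals. -/
def iter (Ψ : A → (A → ℝ≥0∞) → ℝ≥0∞) : ℕ → A → (A → ℝ≥0∞) → ℝ≥0∞
  | 0, a, φ => φ a
  | N + 1, a, φ => Ψ a fun b => iter Ψ N b φ

theorem loop {body : Mem → PMF (Mem × ℕ)} {C : ℕ} {R : A → Mem → Prop}
    {Ψ : A → (A → ℝ≥0∞) → ℝ≥0∞} (hbody : ∀ a s, R a s → Simulates (body s) C R (Ψ a)) (N : ℕ) :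
    ∀ a s, R a s → Simulates (loop body N s) (N * (C + 1)) R (iter Ψ N a) := by
  induction N with
  | zero =>
    intro a s hs φ g hg
    simp only [MCS.loop, expect_pure]
    exact hg a _ hs (Nat.zero_le _)
  | succ N ih =>
    intro a s hs φ g hg
    simp only [MCS.loop, expect_bind, expect_pure]
    refine hbody a s hs _ _ fun b o hR ho => ?_
    refine ih b o.1 hR φ (fun o₂ => g (o₂.1, o.2 + o₂.2 + 1)) fun b o₂ hR₂ ho₂ => hg b _ hR₂ ?_
    rw [Nat.succ_mul]
    dsimp only
    omega

theorem rep {s : Mem} {e : AExp} {p : Prog} {C N : ℕ} {R : A → Mem → Prop}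
    {Ψ : A → (A → ℝ≥0∞) → ℝ≥0∞} (hbody : ∀ a s, R a s → Simulates (p.run s) C R (Ψ a))
    (hN : e.eval s = N) (a : A) (hs : R a s) :
    Simulates ((Prog.rep e p).run s) (N * (C + 1) + (e.cost s + bits N)) R (iter Ψ N a) := by
  intro φ g hg
  simp only [Prog.run, hN, expect_bind, expect_pure, Int.toNat_natCast]
  refine loop hbody N a s hs φ (fun o => g (o.1, _ + o.2)) fun b o hR ho => hg b _ hR ?_
  dsimp only
  omega

theorem rand {s : Mem} {x N : ℕ} {e : AExp} (hN : e.eval s = N) :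
    Simulates ((Prog.rand x e).run s) (e.cost s + bits N)
      (fun (v : Fin (N - 1 + 1)) s' => s' = s.setReg x ((v : ℕ) : ℤ))
      (fun φ => ∑ v, ((N - 1 + 1 : ℕ) : ℝ≥0∞)⁻¹ * φ v) := by
  intro φ g hg
  -- The index type of the random choice depends on the value of `e`, which is generalized.
  have key : ∀ z : ℤ, z = N → ∑ v, ((N - 1 + 1 : ℕ) : ℝ≥0∞)⁻¹ * φ v ≤
      expect ((PMF.uniformOfFintype (Fin (z.toNat - 1 + 1))).bind fun v =>
        PMF.pure (s.setReg x ((v : ℕ) : ℤ), e.cost s + bits z)) g := by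
    rintro _ rfl
    simp only [expect_bind, expect_pure, expect_uniformOfFintype, Fintype.card_fin]
    exact Finset.sum_le_sum fun v _ => mul_le_mul_right (hg v _ rfl le_rfl) _
  exact key _ hN

theorem ifLE {s : Mem} {e₁ e₂ : AExp} {p q : Prog} {C : ℕ} {R : A → Mem → Prop}
    {Φ : (A → ℝ≥0∞) → ℝ≥0∞} (hp : e₁.eval s ≤ e₂.eval s → Simulates (p.run s) C R Φ)
    (hq : ¬ e₁.eval s ≤ e₂.eval s → Simulates (q.run s) C R Φ) :
    Simulates ((Prog.ifLE e₁ e₂ p q).run s)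
      (e₁.cost s + e₂.cost s + bits (e₁.eval s) + bits (e₂.eval s) + C) R Φ := by
  intro φ g hg
  simp only [Prog.run, expect_bind, expect_pure]
  split_ifs with h
  · exact hp h φ _ fun b o hR ho => hg b _ hR (Nat.add_le_add_left ho _)
  · exact hq h φ _ fun b o hR ho => hg b _ hR (Nat.add_le_add_left ho _)

/-- If the abstract process has total mass one, all outcomes represent an abstract state and obey
the bound on the cost. -/
theorem ensures {μ : PMF (Mem × ℕ)} {C : ℕ} {R : A → Mem → Prop} {Φ : (A → ℝ≥0∞) → ℝ≥0∞}
    (h : Simulates μ C R Φ) (hΦ : 1 ≤ Φ fun _ => 1) : Ensures μ C (fun s => ∃ a, R a s) := by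
  have h1 := hΦ.trans (h (fun _ => 1) (Set.indicator {o | (∃ a, R a o.1) ∧ o.2 ≤ C} 1)
    fun a o hR ho => by
      rw [Set.indicator_of_mem (show o ∈ {o | (∃ a, R a o.1) ∧ o.2 ≤ C} from ⟨⟨a, hR⟩, ho⟩)]
      exact le_rfl)
  have h2 : expect μ (Set.indicator {o | (∃ a, R a o.1) ∧ o.2 ≤ C} 1) = 1 :=
    le_antisymm ((expect_mono μ fun o _ =>
    Set.indicator_le_self' (fun _ _ => zero_le_one) o).trans_eq (expect_const μ 1)) h1
  rw [expect_indicator, PMF.toOuterMeasure_apply_eq_one_iff] at h2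
  exact fun o ho => h2 ho

end Simulates

theorem Ensures.rep {s : Mem} {e : AExp} {p : Prog} {C N : ℕ} (Inv : ℕ → Mem → Prop)
    (hN : e.eval s = N) (hbody : ∀ i < N, ∀ s, Inv i s → Ensures (p.run s) C (Inv (i + 1)))
    (hs : Inv 0 s) :
    Ensures ((Prog.rep e p).run s) (N * (C + 1) + (e.cost s + bits N)) (Inv N) := by
  intro o ho
  simp only [Prog.run, hN, PMF.mem_support_bind_iff, PMF.support_pure,
    Set.mem_singleton_iff, Int.toNat_natCast] at ho
  obtain ⟨o₁, h₁, rfl⟩ := ho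
  obtain ⟨hQ, hc⟩ := Ensures.loop N Inv hbody s hs o₁ h₁
  refine ⟨hQ, ?_⟩
  dsimp only
  omega

theorem Ensures.ifLE {s : Mem} {e₁ e₂ : AExp} {p q : Prog} {C : ℕ} {Q : Mem → Prop}
    (hp : e₁.eval s ≤ e₂.eval s → Ensures (p.run s) C Q)
    (hq : ¬ e₁.eval s ≤ e₂.eval s → Ensures (q.run s) C Q) :
    Ensures ((Prog.ifLE e₁ e₂ p q).run s)
      (e₁.cost s + e₂.cost s + bits (e₁.eval s) + bits (e₂.eval s) + C) Q := by
  intro o ho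
  simp only [Prog.run, PMF.mem_support_bind_iff, PMF.support_pure, Set.mem_singleton_iff] at ho
  obtain ⟨o₁, h₁, rfl⟩ := ho
  split_ifs at h₁ with h
  · exact ⟨(hp h o₁ h₁).1, Nat.add_le_add_left (hp h o₁ h₁).2 _⟩
  · exact ⟨(hq h o₁ h₁).1, Nat.add_le_add_left (hq h o₁ h₁).2 _⟩

/-! ### Bit lengths -/

theorem bits_le_bits {z : ℤ} {M : ℕ} (h : |z| ≤ M) : bits z ≤ bits M := by
  unfold bits
  have : z.natAbs ≤ (M : ℤ).natAbs := by
    rw [Int.natAbs_natCast, ← Int.ofNat_le, Int.natCast_natAbs]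
    exact h
  exact Nat.add_le_add_right (Nat.size_le_size this) 1

theorem bits_two_pow (w : ℕ) : bits ((2 ^ w : ℕ) : ℤ) = w + 2 := by
  unfold bits
  rw [Int.natAbs_natCast, Nat.size_pow]

theorem bits_natCast_le (N : ℕ) : bits N ≤ N + 1 := by
  unfold bits
  rw [Int.natAbs_natCast]
  exact Nat.add_le_add_right (Nat.size_le.2 Nat.lt_two_pow_self) 1

theorem one_le_bits (z : ℤ) : 1 ≤ bits z := Nat.le_add_left _ _

end MCS

namespace MCS

/-! ### Cost and effect of the subroutines -/

namespace Mem

@[simp] theorem setReg_reg_self (s : Mem) (x : ℕ) (v : ℤ) : (s.setReg x v).reg x = v := by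
  simp [setReg]

theorem setReg_reg_of_ne (s : Mem) {x y : ℕ} (v : ℤ) (h : y ≠ x) :
    (s.setReg x v).reg y = s.reg y := by
  simp [setReg, h]

@[simp] theorem setReg_arr (s : Mem) (x : ℕ) (v : ℤ) : (s.setReg x v).arr = s.arr := rfl

@[simp] theorem setArr_reg (s : Mem) (a i : ℕ) (v : ℤ) : (s.setArr a i v).reg = s.reg := rfl

@[simp] theorem setArr_arr_self (s : Mem) (a i : ℕ) (v : ℤ) :
    (s.setArr a i v).arr a i = v := by
  simp [setArr]

theorem setArr_arr_of_ne (s : Mem) {a a' : ℕ} (i : ℕ) (v : ℤ) (h : a' ≠ a) :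
    (s.setArr a i v).arr a' = s.arr a' := by
  simp [setArr, h]

theorem setArr_arr_self_of_ne (s : Mem) (a : ℕ) {i i' : ℕ} (v : ℤ) (h : i' ≠ i) :
    (s.setArr a i v).arr a i' = s.arr a i' := by
  simp [setArr, h]

end Mem

namespace Search

/-- Rule for loops over the coordinates: the invariant may not depend on the running index. -/
theorem forIdx_ensures {s : Mem} {p : Prog} {C M d : ℕ} (Inv : ℕ → Mem → Prop)
    (hd : s.reg 0 = d) (hM : d + 1 ≤ M)
    (hInv : ∀ i s v, Inv i s → Inv i (s.setReg idx v)) (hs : Inv 0 s)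
    (hbody : ∀ i < d, ∀ s, Inv i s → s.reg idx = i →
      Ensures (p.run s) C (fun s' => Inv (i + 1) s' ∧ s'.reg idx = i)) :
    Ensures ((forIdx p).run s) (d * (C + 5 * bits M + 1) + 4 * bits M) (Inv d) := by
  have hbits : ∀ i : ℕ, i ≤ d + 1 → bits i ≤ bits M := fun i hi =>
    bits_le_bits (by rw [abs_of_nonneg (by positivity)]; exact_mod_cast hi.trans hM)
  have h0 := hbits 0 (by omega)
  have h1 := hbits 1 (by omega)
  have hdM := hbits d (by omega)
  have hone := one_le_bits M
  refine Ensures.mono (C := 2 * bits M + (d * (C + 5 * bits M + 1) + (bits d + bits d)))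
    (Q := fun s' => Inv d s' ∧ s'.reg idx = d) ?_ (by omega) fun s' h => h.1
  refine Ensures.seq (Q₁ := fun s' => (Inv 0 s' ∧ s'.reg idx = (0 : ℕ)) ∧ s'.reg 0 = d) ?_ ?_
  · refine Ensures.assign ⟨⟨hInv _ _ _ hs, by simp [AExp.eval]⟩, ?_⟩ ?_
    · rw [Mem.setReg_reg_of_ne _ _ (by decide), hd]
    · simp only [AExp.eval, AExp.cost]
      simp only [Nat.cast_zero] at h0
      omega
  · rintro s' ⟨hs', hd'⟩
    have hrep := Ensures.rep (s := s') (e := dim) (N := d) (C := C + 5 * bits M)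
      (p := .seq p (.assign idx (.add (.reg idx) (.const 1))))
      (fun i s => Inv i s ∧ s.reg idx = i) hd' ?_ hs'
    · refine hrep.mono ?_ fun _ h => h
      simp only [AExp.cost, hd']
      omega
    · rintro i hi s ⟨hI, hidx⟩
      refine Ensures.seq (hbody i hi s hI hidx) ?_
      rintro s' ⟨hI', hidx'⟩
      refine Ensures.assign ⟨hInv _ _ _ hI', by simp [AExp.eval, hidx']⟩ ?_
      have hi0 := hbits i (by omega)
      have hi1 := hbits (i + 1) (by omega)
      push_cast at hi1
      simp only [Nat.cast_one] at h1
      simp only [AExp.eval, AExp.cost, hidx']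
      omega

theorem copyArr_ensures {s : Mem} {a b d M : ℕ} (hab : a ≠ b) (hd : s.reg 0 = d)
    (hM : d + 1 ≤ M) (ha : ∀ i < d, |s.arr a i| ≤ M) :
    Ensures ((copyArr a b).run s) (d * (11 * bits M + 1) + 4 * bits M)
      (fun s' => (∀ x, x ≠ idx → s'.reg x = s.reg x) ∧ (∀ a', a' ≠ b → s'.arr a' = s.arr a') ∧
        ∀ i < d, s'.arr b i = s.arr a i) := by
  refine (forIdx_ensures (C := 6 * bits M) (fun i s' => (∀ x, x ≠ idx → s'.reg x = s.reg x) ∧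
    (∀ a', a' ≠ b → s'.arr a' = s.arr a') ∧ ∀ j < i, s'.arr b j = s.arr a j) hd hM ?_ ?_ ?_).mono
    (by ring_nf; omega) fun _ h => h
  · rintro i s' v ⟨hr, h2, h3⟩
    refine ⟨fun x hx => ?_, h2, h3⟩
    rw [Mem.setReg_reg_of_ne _ _ hx, hr x hx]
  · exact ⟨fun _ _ => rfl, fun _ _ => rfl, fun _ h => absurd h (Nat.not_lt_zero _)⟩
  · rintro i hi s' ⟨hr, h2, h3⟩ hidx
    refine Ensures.store ?_ ?_
    · simp only [AExp.eval, hidx, Int.toNat_natCast]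
      refine ⟨⟨hr, fun a' ha' => ?_, fun j hj => ?_⟩, hidx⟩
      · rw [Mem.setArr_arr_of_ne _ _ _ ha', h2 a' ha']
      · by_cases hji : j = i
        · subst hji
          rw [Mem.setArr_arr_self, h2 a hab]
        · rw [Mem.setArr_arr_self_of_ne _ _ _ hji]
          exact h3 j (by omega)
    · have hb := bits_le_bits (ha i hi)
      have hib : bits (i : ℤ) ≤ bits M :=
        bits_le_bits (by rw [abs_of_nonneg (by positivity)]; exact_mod_cast (by omega))
      simp only [AExp.eval, AExp.cost, hidx, Int.toNat_natCast, h2 a hab]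
      omega

theorem evalObj_ensures {s : Mem} {a x d M : ℕ} (hx : 6 < x) (hd : s.reg 0 = d)
    (hM : d + 1 ≤ M) (ha : ∀ i < d, |s.arr a i| ≤ M) (hc : ∀ i < d, |s.arr cArr i| ≤ M)
    (hac : ∀ i < d, |s.arr cArr i * s.arr a i| ≤ M)
    (hsum : ∀ i ≤ d, |s.reg 5 + ∑ l ∈ Finset.range i, s.arr cArr l * s.arr a l| ≤ M) :
    Ensures ((evalObj a x).run s)
      (d * (15 * bits M + bits M * bits M + 1) + 6 * bits M)
      (fun s' => (∀ y, y ≠ idx → y ≠ x → s'.reg y = s.reg y) ∧ s'.arr = s.arr ∧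
        s'.reg x = s.reg 5 + ∑ l ∈ Finset.range d, s.arr cArr l * s.arr a l) := by
  have h0 := bits_le_bits (hsum 0 (Nat.zero_le _))
  simp only [Finset.range_zero, Finset.sum_empty, add_zero] at h0
  refine (Ensures.seq (C₁ := 2 * bits M)
    (C₂ := d * (10 * bits M + bits M * bits M + 5 * bits M + 1) + 4 * bits M)
    (Q₁ := fun s' => (∀ y, y ≠ idx → y ≠ x → s'.reg y = s.reg y) ∧ s'.arr = s.arr ∧
      s'.reg x = s.reg 5 + ∑ l ∈ Finset.range 0, s.arr cArr l * s.arr a l)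
    (Ensures.assign ?_ ?_) ?_).mono (by ring_nf; omega) fun _ h => h
  · refine ⟨fun y _ hy => Mem.setReg_reg_of_ne _ _ hy, rfl, ?_⟩
    simp [AExp.eval]
  · simp only [AExp.eval, AExp.cost]
    omega
  · rintro s₁ hs₁
    have hd₁ : s₁.reg 0 = d := by rw [hs₁.1 0 (by decide) (by omega), hd]
    refine forIdx_ensures (C := 10 * bits M + bits M * bits M) (fun i s' =>
      (∀ y, y ≠ idx → y ≠ x → s'.reg y = s.reg y) ∧ s'.arr = s.arr ∧
        s'.reg x = s.reg 5 + ∑ l ∈ Finset.range i, s.arr cArr l * s.arr a l) hd₁ hM ?_ hs₁ ?_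
    · rintro i s' v ⟨hr, h2, h3⟩
      refine ⟨fun y hy hy' => ?_, h2, ?_⟩
      · rw [Mem.setReg_reg_of_ne _ _ hy, hr y hy hy']
      · rw [Mem.setReg_reg_of_ne _ _ (by unfold idx; omega), h3]
    · rintro i hi s' ⟨hr, h2, h3⟩ hidx
      refine Ensures.assign ?_ ?_
      · simp only [AExp.eval, hidx, Int.toNat_natCast]
        refine ⟨⟨fun y hy hy' => ?_, h2, ?_⟩, ?_⟩
        · rw [Mem.setReg_reg_of_ne _ _ hy', hr y hy hy']
        · rw [Mem.setReg_reg_self, h3, h2, Finset.sum_range_succ, add_assoc]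
        · rw [Mem.setReg_reg_of_ne _ _ (by unfold idx; omega), hidx]
      · have hib : bits (i : ℤ) ≤ bits M :=
          bits_le_bits (by rw [abs_of_nonneg (by positivity)]; exact_mod_cast (by omega))
        have b1 := bits_le_bits (ha i hi)
        have b2 := bits_le_bits (hc i hi)
        have b3 := bits_le_bits (hac i hi)
        have b4 := bits_le_bits (hsum i hi.le)
        have b5 := bits_le_bits (hsum (i + 1) hi)
        rw [Finset.sum_range_succ, ← add_assoc] at b5
        have b6 := Nat.mul_le_mul b2 b1
        simp only [AExp.eval, AExp.cost, hidx, Int.toNat_natCast, h2, h3]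
        omega

/-- The update of the position in one step of the walk, for generator `g` and sign `σ`. -/
theorem walkUpdate_ensures {s : Mem} {d M r g : ℕ} {σ : ℤ} (hd : s.reg 0 = d) (hr : s.reg 2 = r)
    (hr0 : 0 < r) (hg : s.reg gen = g) (hσ : s.reg sgn = σ) (hσ1 : |σ| ≤ 1)
    (hM : d + 1 ≤ M) (hgM : g * d + d ≤ M) (hrM : 2 * r ≤ M)
    (hgM' : g ≤ M) (hw : ∀ i < d, |s.arr wArr i| ≤ r)
    (hh : ∀ i < d, |s.arr hArr (g * d + i)| ≤ r) :
    Ensures ((forIdx (.store wArr (.reg idx)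
      (.mod (.add (.get wArr (.reg idx))
        (.mul (.reg sgn) (.get hArr (.add (.mul (.reg gen) dim) (.reg idx))))) modulus))).run s)
      (d * (23 * bits M + 3 * (bits M * bits M) + 1) + 4 * bits M)
      (fun s' => (∀ x, x ≠ idx → s'.reg x = s.reg x) ∧
        (∀ a', a' ≠ wArr → s'.arr a' = s.arr a') ∧
        ∀ i < d, s'.arr wArr i = (s.arr wArr i + σ * s.arr hArr (g * d + i)) % r) := by
  refine (forIdx_ensures (C := 18 * bits M + 3 * (bits M * bits M))
    (fun i s' => (∀ x, x ≠ idx → s'.reg x = s.reg x) ∧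
    (∀ a', a' ≠ wArr → s'.arr a' = s.arr a') ∧
    (∀ j < i, s'.arr wArr j = (s.arr wArr j + σ * s.arr hArr (g * d + j)) % r) ∧
    ∀ j, i ≤ j → s'.arr wArr j = s.arr wArr j) hd hM ?_ ?_ ?_).mono
    (by ring_nf; omega) fun _ h => ⟨h.1, h.2.1, h.2.2.1⟩
  · rintro i s' v ⟨hr, h2, h3, h4⟩
    refine ⟨fun x hx => ?_, h2, h3, h4⟩
    rw [Mem.setReg_reg_of_ne _ _ hx, hr x hx]
  · exact ⟨fun _ _ => rfl, fun _ _ => rfl, fun _ h => absurd h (Nat.not_lt_zero _), fun _ _ => rfl⟩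
  · rintro i hi s' ⟨hreg, h2, h3, h4⟩ hidx
    have e0 : s'.reg 0 = d := by rw [hreg 0 (by decide), hd]
    have e2 : s'.reg 2 = r := by rw [hreg 2 (by decide), hr]
    have e7 : s'.reg gen = g := by rw [hreg gen (by decide), hg]
    have e8 : s'.reg sgn = σ := by rw [hreg sgn (by decide), hσ]
    have ea : s'.arr hArr = s.arr hArr := h2 hArr (by decide)
    have ew : s'.arr wArr i = s.arr wArr i := h4 i le_rfl
    have ei : ((g : ℤ) * d + i).toNat = g * d + i := by
      have : ((g : ℤ) * d + i) = ((g * d + i : ℕ) : ℤ) := by push_cast; ring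
      rw [this, Int.toNat_natCast]
    refine Ensures.store ?_ ?_
    · simp only [AExp.eval, hidx, Int.toNat_natCast, e0, e2, e7, e8, ea, ew, ei]
      refine ⟨⟨hreg, fun a' ha' => ?_, fun j hj => ?_, fun j hj => ?_⟩, hidx⟩
      · rw [Mem.setArr_arr_of_ne _ _ _ ha', h2 a' ha']
      · by_cases hji : j = i
        · subst hji
          rw [Mem.setArr_arr_self]
        · rw [Mem.setArr_arr_self_of_ne _ _ _ hji]
          exact h3 j (by omega)
      · rw [Mem.setArr_arr_self_of_ne _ _ _ (by omega)]
        exact h4 j (by omega)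
    · have hnat : ∀ N : ℕ, N ≤ M → bits (N : ℤ) ≤ bits M := fun N hN =>
        bits_le_bits (by rw [abs_of_nonneg (by positivity)]; exact_mod_cast hN)
      have hrM' : ((r : ℤ)) + r ≤ M := by exact_mod_cast (by omega : r + r ≤ M)
      have hle : (r : ℤ) ≤ M := by omega
      have hW := hw i hi
      have hH := hh i hi
      have hσH : |σ * s.arr hArr (g * d + i)| ≤ r := by
        rw [abs_mul]
        calc |σ| * |s.arr hArr (g * d + i)| ≤ 1 * r :=
              mul_le_mul hσ1 hH (abs_nonneg _) zero_le_one
          _ = r := one_mul _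
      have b1 := hnat i (by omega)
      have b2 := hnat d (by omega)
      have b3 := hnat r (by omega)
      have b4 := hnat g hgM'
      have b5 : bits ((g : ℤ) * d) ≤ bits M := by
        have := hnat (g * d) (by omega)
        push_cast at this
        exact this
      have b6 : bits ((g : ℤ) * d + i) ≤ bits M := by
        have := hnat (g * d + i) (by omega)
        push_cast at this
        exact this
      have b7 : bits σ ≤ bits M := bits_le_bits (by omega)
      have b8 := bits_le_bits (hW.trans hle)
      have b9 := bits_le_bits (hH.trans hle)
      have b10 := bits_le_bits (hσH.trans hle)
      have b11 : bits (s.arr wArr i + σ * s.arr hArr (g * d + i)) ≤ bits M :=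
        bits_le_bits ((abs_add_le _ _).trans (by omega))
      have b12 : bits ((s.arr wArr i + σ * s.arr hArr (g * d + i)) % r) ≤ bits M := by
        have hr0' : (0 : ℤ) < r := by exact_mod_cast hr0
        refine bits_le_bits ?_
        rw [abs_of_nonneg (Int.emod_nonneg _ hr0'.ne')]
        exact ((Int.emod_lt_of_pos _ hr0').le).trans hle
      have m1 := Nat.mul_le_mul b4 b2
      have m2 := Nat.mul_le_mul b7 b9
      have m3 := Nat.mul_le_mul b11 b3
      simp only [AExp.eval, AExp.cost, hidx, Int.toNat_natCast, e0, e2, e7, e8, ea, ew, ei]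
      omega

end Search

end MCS

/-! ### The program simulates the Markov chain -/

namespace MCS

namespace GroupRelaxation

variable {m n : ℕ} {I : GroupRelaxation m n}

/-- A common bound for the absolute values of all numbers handled by one round of the search, apart
from the number of walk steps. -/
noncomputable def magnitude (S : I.CyclicGenerators) : ℕ :=
  (S.k + 1) * (I.d + 1) + 2 * I.rTop + 2 + I.scaledShift.natAbs +
    ∑ l, (I.scaledCost l).natAbs * I.rTop

theorem rTop_pos (I : GroupRelaxation m n) : 0 < I.rTop := I.r_pos _

/-- The memory `s` holds the inputs of the search, the iterate `z` and the walk position `w`. -/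
structure Represents (s₀ : Mem) (z w : I.Z) (s : Mem) : Prop where
  reg : ∀ x < 6, s.reg x = s₀.reg x
  gens : s.arr Search.hArr = s₀.arr Search.hArr
  costs : s.arr Search.cArr = s₀.arr Search.cArr
  iterate : ∀ l : Fin I.d, s.arr Search.zArr l = ((z l).val : ℤ)
  position : ∀ l : Fin I.d, s.arr Search.wArr l = ((w l).val : ℤ)

theorem Represents.of_eq {s₀ : Mem} {z w : I.Z} {s s' : Mem} (h : Represents s₀ z w s)
    (hr : ∀ x < 6, s'.reg x = s.reg x) (ha : s'.arr = s.arr) : Represents s₀ z w s' :=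
  ⟨fun x hx => (hr x hx).trans (h.reg x hx), by rw [ha, h.gens], by rw [ha, h.costs],
    by rw [ha]; exact h.iterate, by rw [ha]; exact h.position⟩

theorem Represents.setReg {s₀ : Mem} {z w : I.Z} {s : Mem} (h : Represents s₀ z w s)
    {x : ℕ} (hx : 6 ≤ x) (v : ℤ) : Represents s₀ z w (s.setReg x v) :=
  h.of_eq (fun _ hy => Mem.setReg_reg_of_ne _ _ (by omega)) rfl

/-- The neighbour of `x` for generator number `g` and coin `v`; without generators there is only
`x` itself. -/
noncomputable def CyclicGenerators.move (S : I.CyclicGenerators) (g v : ℕ) (x : I.K) : I.K :=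
  if hg : g < S.k then (if v = 0 then x - S.h ⟨g, hg⟩ else x + S.h ⟨g, hg⟩) else x

section InitMem

variable (S : I.CyclicGenerators) (xhat : I.Z) (isLazy : Bool) (ε : ℝ)

theorem initMem_gens {g : ℕ} (hg : g < S.k) (l : Fin I.d) :
    (initMem S xhat isLazy ε).arr Search.hArr (g * I.d + l) = ((S.h ⟨g, hg⟩ : I.Z) l).val := by
  have hd : 0 < I.d := l.pos
  have h1 : (g * I.d + l) / I.d = g := by
    rw [mul_comm, Nat.mul_add_div hd, Nat.div_eq_of_lt l.2, add_zero]
  have h2 : (g * I.d + l) % I.d = l := by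
    rw [mul_comm, Nat.mul_add_mod, Nat.mod_eq_of_lt l.2]
  have h3 : (g * I.d + l) / I.d < S.k ∧ (g * I.d + l) % I.d < I.d := by
    rw [h1, h2]; exact ⟨hg, l.2⟩
  have e1 : (⟨(g * I.d + l) / I.d, h3.1⟩ : Fin S.k) = ⟨g, hg⟩ := Fin.ext h1
  have e2 : (⟨(g * I.d + l) % I.d, h3.2⟩ : Fin I.d) = l := Fin.ext h2
  simp only [initMem]
  rw [if_neg (by decide), if_pos trivial, dif_pos h3, e1, e2]

theorem initMem_gens_of_k_eq_zero (hk : S.k = 0) (p : ℕ) :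
    (initMem S xhat isLazy ε).arr Search.hArr p = 0 := by
  have : ¬ (p / I.d < S.k ∧ p % I.d < I.d) := fun h => by
    rw [hk] at h
    exact Nat.not_lt_zero _ h.1
  simp [initMem, Search.hArr, Search.zArr, dif_neg this]

theorem initMem_costs (l : Fin I.d) :
    (initMem S xhat isLazy ε).arr Search.cArr l = I.scaledCost l := by
  simp [initMem, Search.hArr, Search.zArr, Search.cArr]

theorem represents_initMem :
    Represents (initMem S xhat isLazy ε) xhat 0 (initMem S xhat isLazy ε) := by
  refine ⟨fun _ _ => rfl, rfl, rfl, fun l => ?_, fun l => ?_⟩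
  · simp [initMem, Search.zArr]
  · simp [initMem, Search.hArr, Search.zArr, Search.cArr, Search.wArr]

variable {S xhat isLazy ε}

/-- The integral objective that the program evaluates; it is `|det A_B|` times `value`. -/
noncomputable def scaledValue (z : I.Z) : ℤ :=
  I.scaledShift + ∑ l, I.scaledCost l * ((z l).val : ℤ)

theorem val_le_rTop (z : I.Z) (l : Fin I.d) : (z l).val ≤ I.rTop := (ZMod.val_lt _).le

theorem natCast_abs_le {a M : ℕ} (h : a ≤ M) : |(a : ℤ)| ≤ M := by
  rw [abs_of_nonneg (by positivity)]
  exact_mod_cast h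

theorem cost_le_magnitude (l : Fin I.d) :
    (I.scaledCost l).natAbs * I.rTop ≤ magnitude S := by
  have := Finset.single_le_sum (f := fun l => (I.scaledCost l).natAbs * I.rTop)
    (fun _ _ => Nat.zero_le _) (Finset.mem_univ l)
  unfold magnitude
  omega

theorem d_lt_magnitude : I.d + 1 ≤ magnitude S := by
  have : I.d + 1 ≤ (S.k + 1) * (I.d + 1) := Nat.le_mul_of_pos_left _ (Nat.succ_pos _)
  unfold magnitude
  omega

theorem mul_d_le_magnitude {g : ℕ} (hg : g ≤ S.k - 1) : g * I.d + I.d ≤ magnitude S := by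
  have h1 : (g + 1) * I.d ≤ (S.k + 1) * (I.d + 1) := Nat.mul_le_mul (by omega) (by omega)
  rw [Nat.succ_mul] at h1
  unfold magnitude
  omega

theorem k_le_magnitude : S.k ≤ magnitude S := by
  have : S.k + 1 ≤ (S.k + 1) * (I.d + 1) := Nat.le_mul_of_pos_right _ (Nat.succ_pos _)
  unfold magnitude
  omega

theorem evalObj_represents {z w y : I.Z} {s : Mem} {a x : ℕ} (hx : 6 < x)
    (hs : Represents (initMem S xhat isLazy ε) z w s)
    (ha : ∀ l : Fin I.d, s.arr a l = ((y l).val : ℤ)) :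
    Ensures ((Search.evalObj a x).run s)
      (I.d * (15 * bits (magnitude S) + bits (magnitude S) * bits (magnitude S) + 1)
        + 6 * bits (magnitude S))
      (fun s' => (∀ y, y ≠ Search.idx → y ≠ x → s'.reg y = s.reg y) ∧ s'.arr = s.arr ∧
        s'.reg x = scaledValue y) := by
  have hd : s.reg 0 = I.d := by rw [hs.reg 0 (by omega)]; simp [initMem]
  have h5 : s.reg 5 = I.scaledShift := by rw [hs.reg 5 (by omega)]; simp [initMem]
  have hc : ∀ l : Fin I.d, s.arr Search.cArr l = I.scaledCost l := fun l => by
    rw [hs.costs, initMem_costs]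
  have hr := I.rTop_pos
  have hcost : ∀ l : Fin I.d, |I.scaledCost l| ≤ (I.scaledCost l).natAbs * I.rTop := fun l => by
    rw [Int.abs_eq_natAbs]
    exact_mod_cast Nat.le_mul_of_pos_right _ hr
  have hterm : ∀ l : Fin I.d, |I.scaledCost l * ((y l).val : ℤ)|
      ≤ (I.scaledCost l).natAbs * I.rTop := fun l => by
    rw [abs_mul, Int.abs_eq_natAbs, Nat.abs_cast]
    exact_mod_cast Nat.mul_le_mul_left _ (val_le_rTop y l)
  refine (Search.evalObj_ensures (M := magnitude S) hx hd d_lt_magnitude ?_ ?_ ?_ ?_).mono le_rfl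
    fun s' ⟨h1, h2, h3⟩ => ⟨h1, h2, ?_⟩
  · intro i hi
    rw [ha ⟨i, hi⟩]
    refine natCast_abs_le ((val_le_rTop y _).trans ?_)
    unfold magnitude; omega
  · intro i hi
    rw [hc ⟨i, hi⟩]
    exact (hcost _).trans (by exact_mod_cast cost_le_magnitude _)
  · intro i hi
    rw [hc ⟨i, hi⟩, ha ⟨i, hi⟩]
    exact (hterm _).trans (by exact_mod_cast cost_le_magnitude _)
  · intro i hi
    rw [h5]
    have hsub : |∑ l ∈ Finset.range i, s.arr Search.cArr l * s.arr a l| ≤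
        ((∑ l : Fin I.d, (I.scaledCost l).natAbs * I.rTop : ℕ) : ℤ) := by
      refine (Finset.abs_sum_le_sum_abs _ _).trans ?_
      calc ∑ l ∈ Finset.range i, |s.arr Search.cArr l * s.arr a l|
          ≤ ∑ l ∈ Finset.range I.d, |s.arr Search.cArr l * s.arr a l| :=
            Finset.sum_le_sum_of_subset_of_nonneg (Finset.range_mono hi)
              fun _ _ _ => abs_nonneg _
        _ = ∑ l : Fin I.d, |s.arr Search.cArr l * s.arr a l| := Finset.sum_range _
        _ ≤ ∑ l : Fin I.d, (((I.scaledCost l).natAbs * I.rTop : ℕ) : ℤ) := by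
            refine Finset.sum_le_sum fun l _ => ?_
            rw [hc, ha]
            exact_mod_cast hterm l
        _ = _ := by push_cast; rfl
    refine (abs_add_le _ _).trans ?_
    rw [Int.abs_eq_natAbs I.scaledShift]
    unfold magnitude
    push_cast at hsub ⊢
    have h6 : (0 : ℤ) ≤ ((S.k : ℤ) + 1) * (I.d + 1) := by positivity
    omega
  · rw [h3, h5, scaledValue, Finset.sum_range]
    simp only [hc, ha]

/-- The cost of one step of the walk, in terms of the dimension and the word size. -/
def stepCost (d β : ℕ) : ℕ := 21 * β + β * β + d * (23 * β + 3 * (β * β) + 1)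

/-- One step of the walk on the coset `xhat + K`, described by its position relative to `xhat`. The
index sets are those of the random choices of the program; `S.k - 1 + 1 = 1` without generators. -/
theorem cayleyStep_simulates {z : I.Z} (y : I.K) {s : Mem}
    (hs : Represents (initMem S xhat isLazy ε) z (xhat + y) s) :
    Simulates (Search.cayleyStep.run s)
      (14 * bits (magnitude S) + bits (magnitude S) * bits (magnitude S) +
        I.d * (23 * bits (magnitude S) + 3 * (bits (magnitude S) * bits (magnitude S)) + 1))
      (fun y' : I.K => Represents (initMem S xhat isLazy ε) z (xhat + y'))
      (fun φ => ∑ g : Fin (S.k - 1 + 1), ((S.k - 1 + 1 : ℕ) : ℝ≥0∞)⁻¹ *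
        ∑ v : Fin (2 - 1 + 1), ((2 - 1 + 1 : ℕ) : ℝ≥0∞)⁻¹ * φ (S.move g v y)) := by
  have hd : (initMem S xhat isLazy ε).reg 0 = I.d := by simp [initMem]
  have hk : s.reg 1 = S.k := by rw [hs.reg 1 (by omega)]; simp [initMem]
  have hr : (initMem S xhat isLazy ε).reg 2 = I.rTop := by simp [initMem]
  have hM : 2 ≤ magnitude S := by unfold magnitude; omega
  set M := magnitude S with hMdef
  have c1 : bits 1 ≤ bits M := bits_le_bits (natCast_abs_le (a := 1) (by omega))
  have c2 : bits 2 ≤ bits M := bits_le_bits (natCast_abs_le (a := 2) (by omega))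
  have ck : bits S.k ≤ bits M := bits_le_bits (natCast_abs_le k_le_magnitude)
  refine ((Simulates.rand (e := Search.numGen) hk).seq (C₂ := 2 * bits M +
    (6 * bits M + bits M * bits M + (I.d * (23 * bits M + 3 * (bits M * bits M) + 1) + 4 * bits M)))
    (Ψ := fun (g : Fin (S.k - 1 + 1)) φ =>
      ∑ v : Fin (2 - 1 + 1), ((2 - 1 + 1 : ℕ) : ℝ≥0∞)⁻¹ * φ (S.move g v y)) ?_).mono ?_
      fun φ => le_rfl
  swap
  · simp only [AExp.cost, hk]
    omega
  rintro g s₁ rfl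
  refine ((Simulates.rand (e := .const 2) (N := 2) rfl).seq
    (Ψ := fun (v : Fin (2 - 1 + 1)) φ => φ (S.move g v y)) ?_).mono
    (show _ ≤ _ from Nat.add_le_add_right (m := 2 * bits M) ?_ _) fun φ => le_rfl
  swap
  · simp only [AExp.cost]
    push_cast
    omega
  rintro v s₁ rfl
  have hs₁ := (hs.setReg (x := Search.gen) (by decide) ((g : ℕ) : ℤ)).setReg
    (x := Search.sgn) (by decide) ((v : ℕ) : ℤ)
  set s₁ := (s.setReg Search.gen ((g : ℕ) : ℤ)).setReg Search.sgn ((v : ℕ) : ℤ)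
  have hv : ((v : ℕ) : ℤ) ≤ 1 := by have := v.2; omega
  set σ : ℤ := 2 * ((v : ℕ) : ℤ) - 1 with hσ
  have hσ1 : |σ| ≤ 1 := by rw [abs_le]; omega
  refine (Ensures.seq (Q₁ := fun s₂ => Represents (initMem S xhat isLazy ε) z (xhat + y) s₂ ∧
    s₂.reg Search.gen = (g : ℕ) ∧ s₂.reg Search.sgn = σ) (Ensures.assign ?_ ?_) ?_).simulates
  · refine ⟨hs₁.setReg (by decide) _, ?_, ?_⟩
    · rw [Mem.setReg_reg_of_ne _ _ (by decide), Mem.setReg_reg_of_ne _ _ (by decide),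
        Mem.setReg_reg_self]
    · rw [Mem.setReg_reg_self]
      simp [AExp.eval, s₁, hσ]
  · have b1 : bits ((v : ℕ) : ℤ) ≤ bits M := bits_le_bits (natCast_abs_le (by have := v.2; omega))
    have b2 : bits (2 * ((v : ℕ) : ℤ)) ≤ bits M := bits_le_bits (by rw [abs_le]; omega)
    have b3 : bits (2 * ((v : ℕ) : ℤ) - 1) ≤ bits M := bits_le_bits (by rw [abs_le]; omega)
    have b4 := Nat.mul_le_mul c2 b1
    have e1 : s₁.reg Search.sgn = (v : ℕ) := Mem.setReg_reg_self _ _ _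
    simp only [AExp.eval, AExp.cost, e1]
    omega
  rintro s₂ ⟨hs₂, hg₂, hσ₂⟩
  have hgk : (g : ℕ) ≤ S.k - 1 := Nat.lt_succ_iff.1 g.2
  have hpos : ∀ l : Fin I.d, |s₂.arr Search.wArr l| ≤ I.rTop := fun l => by
    rw [hs₂.position]; exact natCast_abs_le (val_le_rTop _ _)
  refine (Search.walkUpdate_ensures (d := I.d) (M := M) (r := I.rTop) (g := g) (σ := σ)
    (by rw [hs₂.reg 0 (by omega), hd]) (by rw [hs₂.reg 2 (by omega), hr]) I.rTop_pos hg₂ hσ₂ hσ1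
    d_lt_magnitude (mul_d_le_magnitude hgk) ?_
    ((hgk.trans (Nat.sub_le _ _)).trans k_le_magnitude) (fun i hi => hpos ⟨i, hi⟩)
    ?_).mono le_rfl ?_
  · rw [hMdef]; unfold magnitude; omega
  · intro i hi
    rw [hs₂.gens]
    by_cases hg : (g : ℕ) < S.k
    · rw [initMem_gens S xhat isLazy ε hg ⟨i, hi⟩]
      exact natCast_abs_le (val_le_rTop _ _)
    · rw [initMem_gens_of_k_eq_zero S xhat isLazy ε (by omega)]
      simp
  · rintro s₃ ⟨h1, h2, h3⟩
    refine ⟨fun x hx => by rw [h1 x (by unfold Search.idx; omega), hs₂.reg x hx],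
      by rw [h2 _ (by decide), hs₂.gens], by rw [h2 _ (by decide), hs₂.costs],
      fun l => by rw [h2 _ (by decide), hs₂.iterate], fun l => ?_⟩
    rw [h3 l l.2, hs₂.position, hs₂.gens]
    by_cases hg : (g : ℕ) < S.k
    · rw [initMem_gens S xhat isLazy ε hg, ← ZMod.val_intCast]
      congr 2
      unfold CyclicGenerators.move
      rw [dif_pos hg]
      push_cast
      simp only [ZMod.natCast_val, ZMod.cast_id', id_eq]
      split_ifs with hv0
      · simp [hσ, hv0, sub_eq_add_neg, add_assoc]
      · have hv1 : (v : ℕ) = 1 := by have := v.2; omega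
        simp [hσ, hv1, add_assoc]
    · rw [initMem_gens_of_k_eq_zero S xhat isLazy ε (by omega)]
      unfold CyclicGenerators.move
      rw [dif_neg hg, mul_zero, add_zero]
      exact_mod_cast Nat.mod_eq_of_lt (ZMod.val_lt _)

end InitMem

end GroupRelaxation

end MCS

namespace MCS

namespace GroupRelaxation

variable {m n : ℕ} {I : GroupRelaxation m n}

/-! ### Transition matrices as expectation functionals -/

/-- The expectation functional of one step from `x` of the chain with transition matrix `P`. -/
noncomputable def kernelOf {α : Type*} [Fintype α] (P : Matrix α α ℝ) (x : α)
    (φ : α → ℝ≥0∞) : ℝ≥0∞ := ∑ y, ENNReal.ofReal (P x y) * φ y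

theorem iter_kernelOf {α : Type*} [Fintype α] [DecidableEq α] {P : Matrix α α ℝ}
    (hP : P ∈ rowStochastic ℝ α) (t : ℕ) :
    ∀ (x : α) (φ : α → ℝ≥0∞), Simulates.iter (kernelOf P) t x φ = kernelOf (P ^ t) x φ := by
  induction t with
  | zero =>
    intro x φ
    simp [Simulates.iter, kernelOf, Matrix.one_apply, apply_ite ENNReal.ofReal]
  | succ t ih =>
    intro x φ
    have h0 : ∀ i j, 0 ≤ (P ^ t) i j := fun i j => nonneg_of_mem_rowStochastic (pow_mem hP t)
    simp only [Simulates.iter, ih]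
    unfold kernelOf
    simp only [pow_succ', Matrix.mul_apply, Finset.mul_sum]
    rw [Finset.sum_comm]
    refine Finset.sum_congr rfl fun z _ => ?_
    rw [ENNReal.ofReal_sum_of_nonneg fun y _ =>
      mul_nonneg (nonneg_of_mem_rowStochastic hP) (h0 _ _), Finset.sum_mul]
    refine Finset.sum_congr rfl fun y _ => ?_
    rw [ENNReal.ofReal_mul (nonneg_of_mem_rowStochastic hP), mul_assoc]

theorem walk_of_k_eq_zero {S : I.CyclicGenerators} (hk : S.k = 0) : S.walk = 1 := if_pos hk

theorem walk_apply {S : I.CyclicGenerators} (hk : S.k ≠ 0) (x y : I.K) :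
    S.walk x y = ∑ j, ((1 : ℝ) / (2 * S.k)) *
      ((if y = x + S.h j then 1 else 0) + (if y = x - S.h j then 1 else 0)) := by
  have h : S.walk = fun x y => ∑ j, ((1 : ℝ) / (2 * S.k)) *
      ((if y = x + S.h j then 1 else 0) + (if y = x - S.h j then 1 else 0)) := if_neg hk
  exact congrFun (congrFun h x) y

theorem walk_nonneg (S : I.CyclicGenerators) (x y : I.K) : 0 ≤ S.walk x y := by
  by_cases hk : S.k = 0
  · rw [walk_of_k_eq_zero hk, Matrix.one_apply]
    split_ifs <;> norm_num
  · rw [walk_apply hk]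
    refine Finset.sum_nonneg fun j _ => mul_nonneg (by positivity) (add_nonneg ?_ ?_) <;>
      split_ifs <;> norm_num

theorem walk_row_sum (S : I.CyclicGenerators) (x : I.K) : ∑ y, S.walk x y = 1 := by
  by_cases hk : S.k = 0
  · simp [walk_of_k_eq_zero hk, Matrix.one_apply]
  · simp only [walk_apply hk]
    rw [Finset.sum_comm]
    have hk' : (S.k : ℝ) ≠ 0 := by exact_mod_cast hk
    simp only [← Finset.mul_sum, Finset.sum_add_distrib, Finset.sum_ite_eq', Finset.mem_univ,
      if_true, Finset.sum_const, Finset.card_univ, Fintype.card_fin, nsmul_eq_mul]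
    field_simp
    norm_num

theorem walk_mem_rowStochastic (S : I.CyclicGenerators) : S.walk ∈ rowStochastic ℝ I.K := by
  rw [mem_rowStochastic_iff_sum]
  exact ⟨walk_nonneg S, walk_row_sum S⟩

theorem chain_mem_rowStochastic (S : I.CyclicGenerators) (isLazy : Bool) :
    S.chain isLazy ∈ rowStochastic ℝ I.K := by
  unfold CyclicGenerators.chain
  split_ifs
  · rw [smul_add]
    exact convex_rowStochastic (one_mem _) (walk_mem_rowStochastic S) (by norm_num)
      (by norm_num) (by norm_num)
  · exact walk_mem_rowStochastic S

theorem kernelOf_one {α : Type*} [Fintype α] [DecidableEq α] (x : α) (φ : α → ℝ≥0∞) :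
    kernelOf (1 : Matrix α α ℝ) x φ = φ x := by
  simp [kernelOf, Matrix.one_apply, apply_ite ENNReal.ofReal]

/-- The random choices of the program have the law prescribed by the transition matrix. -/
theorem kernelOf_walk (S : I.CyclicGenerators) (y : I.K) (φ : I.K → ℝ≥0∞) :
    kernelOf S.walk y φ = ∑ g : Fin (S.k - 1 + 1), ((S.k - 1 + 1 : ℕ) : ℝ≥0∞)⁻¹ *
        ∑ v : Fin (2 - 1 + 1), ((2 - 1 + 1 : ℕ) : ℝ≥0∞)⁻¹ * φ (S.move g v y) := by
  have hhalf : ∀ a : ℝ≥0∞, 2⁻¹ * a + 2⁻¹ * a = a := fun a => by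
    rw [← add_mul, ENNReal.inv_two_add_inv_two, one_mul]
  rw [Fin.sum_univ_eq_sum_range (fun g => ((S.k - 1 + 1 : ℕ) : ℝ≥0∞)⁻¹ *
        ∑ v : Fin (2 - 1 + 1), ((2 - 1 + 1 : ℕ) : ℝ≥0∞)⁻¹ * φ (S.move g v y))]
  by_cases hk : S.k = 0
  · rw [walk_of_k_eq_zero hk, kernelOf_one, ← hhalf (φ y)]
    simp [hk, CyclicGenerators.move, two_mul]
  · have hk1 : S.k - 1 + 1 = S.k := by omega
    rw [hk1, Finset.sum_range]
    have hcoef : ENNReal.ofReal (1 / (2 * S.k)) = (S.k : ℝ≥0∞)⁻¹ * 2⁻¹ := by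
      have hk0 : (0 : ℝ) < S.k := by exact_mod_cast Nat.pos_of_ne_zero hk
      rw [one_div, ENNReal.ofReal_inv_of_pos (by positivity),
        ENNReal.ofReal_mul (by norm_num), ENNReal.ofReal_natCast, mul_comm,
        ENNReal.mul_inv (by simp) (by simp)]
      simp
    have hentry : ∀ y', ENNReal.ofReal (S.walk y y') * φ y' =
        ∑ j : Fin S.k, ((S.k : ℝ≥0∞)⁻¹ * (2⁻¹ * (if y' = y + S.h j then φ y' else 0)) +
          (S.k : ℝ≥0∞)⁻¹ * (2⁻¹ * (if y' = y - S.h j then φ y' else 0))) := by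
      intro y'
      rw [walk_apply hk, ENNReal.ofReal_sum_of_nonneg, Finset.sum_mul]
      · refine Finset.sum_congr rfl fun j _ => ?_
        rw [ENNReal.ofReal_mul (by positivity), hcoef, ENNReal.ofReal_add]
        · simp only [apply_ite ENNReal.ofReal, ENNReal.ofReal_one, ENNReal.ofReal_zero]
          split_ifs <;> ring
        · split_ifs <;> norm_num
        · split_ifs <;> norm_num
      · refine fun j _ => mul_nonneg (by positivity) (add_nonneg ?_ ?_) <;>
          split_ifs <;> norm_num
    unfold kernelOf
    simp only [hentry]
    rw [Finset.sum_comm]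
    refine Finset.sum_congr rfl fun j _ => ?_
    rw [Finset.sum_add_distrib]
    simp only [← Finset.mul_sum, Finset.sum_ite_eq', Finset.mem_univ, if_true]
    rw [← mul_add, ← mul_add]
    simp [Fin.sum_univ_two, CyclicGenerators.move, add_comm]

theorem kernelOf_lazy (S : I.CyclicGenerators) (y : I.K) (φ : I.K → ℝ≥0∞) :
    kernelOf (S.chain true) y φ = 2⁻¹ * kernelOf S.walk y φ + 2⁻¹ * φ y := by
  have h2 : ENNReal.ofReal (1 / 2) = 2⁻¹ := by
    rw [one_div, ENNReal.ofReal_inv_of_pos (by norm_num)]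
    simp
  conv_rhs => rw [← kernelOf_one y φ]
  unfold kernelOf CyclicGenerators.chain
  rw [Finset.mul_sum, Finset.mul_sum, ← Finset.sum_add_distrib]
  refine Finset.sum_congr rfl fun z _ => ?_
  rw [if_pos rfl, Matrix.smul_apply, smul_eq_mul, ENNReal.ofReal_mul (by norm_num), h2,
    Matrix.add_apply, ENNReal.ofReal_add _ (walk_nonneg S y z)]
  · ring
  · rw [Matrix.one_apply]
    split_ifs <;> norm_num

/-! ### One round of the search -/

variable {S : I.CyclicGenerators} {xhat : I.Z} {isLazy : Bool} {ε : ℝ}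

theorem walkStep_simulates {z : I.Z} (y : I.K) {s : Mem}
    (hs : Represents (initMem S xhat isLazy ε) z (xhat + (y : I.Z)) s) :
    Simulates ((Search.walkStep isLazy).run s) (stepCost I.d (bits (magnitude S)))
      (fun y' : I.K => Represents (initMem S xhat isLazy ε) z (xhat + (y' : I.Z)))
      (kernelOf (S.chain isLazy) y) := by
  cases isLazy with
  | false =>
    refine (cayleyStep_simulates y hs).mono ?_ fun φ => ?_
    · unfold stepCost
      omega
    · rw [← kernelOf_walk]
      exact le_rfl
  | true =>
    have hM : 2 ≤ magnitude S := by unfold magnitude; omega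
    have c2 : bits 2 ≤ bits (magnitude S) := bits_le_bits (natCast_abs_le (a := 2) (by omega))
    have c0 : bits 0 ≤ bits (magnitude S) := bits_le_bits (natCast_abs_le (a := 0) (by omega))
    have c' := one_le_bits (magnitude S)
    refine ((Simulates.rand (e := .const 2) (N := 2) rfl).seq
      (C₂ := stepCost I.d (bits (magnitude S)) - 2 * bits (magnitude S))
      (Ψ := fun (v : Fin (2 - 1 + 1)) φ =>
        if (v : ℕ) = 0 then kernelOf S.walk y φ else φ y) ?_).mono ?_ fun φ => ?_
    · rintro v s₁ rfl
      have hs₁ := hs.setReg (x := Search.coin) (by decide) ((v : ℕ) : ℤ)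
      have hv : bits ((v : ℕ) : ℤ) ≤ bits (magnitude S) :=
        bits_le_bits (natCast_abs_le (by have := v.2; omega))
      have heval : (AExp.reg Search.coin).eval (s.setReg Search.coin ((v : ℕ) : ℤ)) = (v : ℕ) :=
        Mem.setReg_reg_self _ _ _
      refine Simulates.mono (C := _ + (14 * bits (magnitude S) +
        bits (magnitude S) * bits (magnitude S) + I.d * (23 * bits (magnitude S) +
          3 * (bits (magnitude S) * bits (magnitude S)) + 1)))
        (Simulates.ifLE (fun h => ?_) fun h => ?_) ?_ fun _ => le_rfl
      · rw [heval] at h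
        have hv0 : (v : ℕ) = 0 := by simp only [AExp.eval] at h; omega
        simp only [hv0, if_true]
        refine (cayleyStep_simulates y ?_).mono le_rfl fun φ => (kernelOf_walk S y φ).le
        simpa only [hv0] using hs₁
      · rw [heval] at h
        have hv0 : (v : ℕ) ≠ 0 := by simp only [AExp.eval] at h; omega
        simp only [hv0, if_false]
        exact Ensures.simulates
          (R := fun y' : I.K => Represents (initMem S xhat true ε) z (xhat + (y' : I.Z))) (a := y)
          (Ensures.pure hs₁ (by omega))
      · simp only [heval, AExp.cost]
        simp only [AExp.eval, Mem.setReg_reg_self]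
        unfold stepCost
        omega
    · simp only [AExp.cost]
      push_cast
      unfold stepCost
      omega
    · rw [kernelOf_lazy]
      simp [Fin.sum_univ_two]

/-- A bound for the cost of one round, in terms of the dimension, the word size and the number of
walk steps; the bit length of `T` is estimated by `T + 1`. -/
def roundCost (d β T : ℕ) : ℕ :=
  2 * (d * (11 * β + 1) + 4 * β) + T * (stepCost d β + 1) + 2 * (T + 1) +
    2 * (d * (15 * β + β * β + 1) + 6 * β) + 4 * β

theorem abs_scaledValue_le (z : I.Z) : |scaledValue z| ≤ magnitude S := by
  have h : |∑ l, I.scaledCost l * ((z l).val : ℤ)| ≤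
      ((∑ l : Fin I.d, (I.scaledCost l).natAbs * I.rTop : ℕ) : ℤ) := by
    refine (Finset.abs_sum_le_sum_abs _ _).trans ?_
    push_cast
    refine Finset.sum_le_sum fun l _ => ?_
    rw [abs_mul, Nat.abs_cast]
    exact mul_le_mul_of_nonneg_left (by exact_mod_cast val_le_rTop z l) (abs_nonneg _)
  refine (abs_add_le _ _).trans ?_
  rw [Int.abs_eq_natAbs I.scaledShift]
  unfold magnitude
  push_cast at h ⊢
  have h6 : (0 : ℤ) ≤ ((S.k : ℤ) + 1) * (I.d + 1) := by positivity
  omega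

/-- One round of the search as an operation on expectation functionals: walk for `T` steps, and
accept the new position if the objective does not increase. -/
noncomputable def roundKernel (S : I.CyclicGenerators) (xhat : I.Z) (isLazy : Bool) (T : ℕ)
    (y : I.K) (φ : I.K → ℝ≥0∞) : ℝ≥0∞ :=
  kernelOf (S.chain isLazy ^ T) y fun y' =>
    φ (if scaledValue (xhat + (y' : I.Z)) ≤ scaledValue (xhat + (y : I.Z)) then y' else y)

theorem round_simulates (y : I.K) {s : Mem} {w : I.Z}
    (hs : Represents (initMem S xhat isLazy ε) (xhat + (y : I.Z)) w s) :
    Simulates ((Prog.seq (Search.copyArr Search.zArr Search.wArr) <|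
      .seq (.rep Search.numSteps (Search.walkStep isLazy)) <|
      .seq (Search.evalObj Search.wArr Search.newVal) <|
      .seq (Search.evalObj Search.zArr Search.oldVal) <|
      .ifLE (.reg Search.newVal) (.reg Search.oldVal)
        (Search.copyArr Search.wArr Search.zArr) .skip).run s)
      (roundCost I.d (bits (magnitude S)) (tMix S xhat isLazy).toNat)
      (fun y' : I.K => fun s' =>
        ∃ w', Represents (initMem S xhat isLazy ε) (xhat + (y' : I.Z)) w' s')
      (roundKernel S xhat isLazy (tMix S xhat isLazy).toNat y) := by
  set T := (tMix S xhat isLazy).toNat with hT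
  set β := bits (magnitude S) with hβ
  have hd0 : (initMem S xhat isLazy ε).reg 0 = I.d := by simp [initMem]
  have hT0 : (initMem S xhat isLazy ε).reg 4 = T := by simp [initMem, hT]
  have hval : ∀ (x : I.Z) (l : Fin I.d), |((x l).val : ℤ)| ≤ magnitude S := fun x l =>
    natCast_abs_le ((val_le_rTop _ _).trans (by unfold magnitude; omega))
  have hbT := bits_natCast_le T
  have hrep : ∀ s₁, Represents (initMem S xhat isLazy ε) (xhat + (y : I.Z)) (xhat + (y : I.Z)) s₁ →
      Simulates ((Prog.rep Search.numSteps (Search.walkStep isLazy)).run s₁)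
        (T * (stepCost I.d β + 1) + 2 * bits T)
        (fun y' : I.K => Represents (initMem S xhat isLazy ε) (xhat + (y : I.Z))
          (xhat + (y' : I.Z))) (kernelOf (S.chain isLazy ^ T) y) := by
    intro s₁ hs₁
    have h4 : s₁.reg 4 = T := by rw [hs₁.reg 4 (by omega), hT0]
    refine (Simulates.rep (s := s₁) (e := Search.numSteps)
      (R := fun y' : I.K => Represents (initMem S xhat isLazy ε) (xhat + (y : I.Z))
        (xhat + (y' : I.Z))) (fun y' s h => walkStep_simulates y' h) h4 y hs₁).mono ?_ fun φ => ?_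
    · simp only [AExp.cost, h4, ← hβ]
      omega
    · rw [iter_kernelOf (chain_mem_rowStochastic S isLazy)]
  refine Simulates.mono (Simulates.ensures_seq
    (Q := Represents (initMem S xhat isLazy ε) (xhat + (y : I.Z)) (xhat + (y : I.Z)))
    ((Search.copyArr_ensures (by decide) (by rw [hs.reg 0 (by omega), hd0]) d_lt_magnitude
      (fun i hi => by rw [hs.iterate ⟨i, hi⟩]; exact hval _ _)).mono le_rfl ?_)
    fun s₁ hs₁ => Simulates.seq (hrep s₁ hs₁)
      (Ψ := fun (y' : I.K) φ =>
        φ (if scaledValue (xhat + (y' : I.Z)) ≤ scaledValue (xhat + (y : I.Z)) then y' else y))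
      (C₂ := 2 * (I.d * (15 * β + β * β + 1) + 6 * β) + 4 * β + (I.d * (11 * β + 1) + 4 * β))
      (R₂ := fun y' : I.K => fun s' =>
        ∃ w', Represents (initMem S xhat isLazy ε) (xhat + (y' : I.Z)) w' s')
      fun y' s₂ hs₂ => ?_)
    ?_ fun φ => ?_
  · rintro s' ⟨h1, h2, h3⟩
    exact ⟨fun x hx => by rw [h1 x (by unfold Search.idx; omega), hs.reg x hx],
      by rw [h2 _ (by decide), hs.gens], by rw [h2 _ (by decide), hs.costs],
      fun l => by rw [h2 _ (by decide), hs.iterate],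
      fun l => by rw [h3 l l.2, hs.iterate]⟩
  · refine Ensures.simulates (R := fun y' : I.K => fun s' =>
      ∃ w', Represents (initMem S xhat isLazy ε) (xhat + (y' : I.Z)) w' s') ?_
    refine Ensures.mono (Ensures.seq (Q₁ := fun s' =>
      Represents (initMem S xhat isLazy ε) (xhat + (y : I.Z)) (xhat + (y' : I.Z)) s' ∧
        s'.reg Search.newVal = scaledValue (xhat + (y' : I.Z)))
      ((evalObj_represents (by decide) hs₂ hs₂.position).mono le_rfl ?_)
      fun s₃ hs₃ => Ensures.seq (C₂ := 4 * β + (I.d * (11 * β + 1) + 4 * β)) (Q₁ := fun s' =>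
        Represents (initMem S xhat isLazy ε) (xhat + (y : I.Z)) (xhat + (y' : I.Z)) s' ∧
        s'.reg Search.newVal = scaledValue (xhat + (y' : I.Z)) ∧
        s'.reg Search.oldVal = scaledValue (xhat + (y : I.Z)))
      ((evalObj_represents (by decide) hs₃.1 hs₃.1.iterate).mono le_rfl ?_)
      fun s₄ ⟨hs₄, hn, ho⟩ => ?_) ?_ fun _ h => h
    · rintro s' ⟨h1, h2, h3⟩
      exact ⟨hs₂.of_eq (fun x hx => h1 x (by unfold Search.idx; omega)
        (by unfold Search.newVal; omega)) h2, h3⟩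
    · rintro s' ⟨h1, h2, h3⟩
      exact ⟨hs₃.1.of_eq (fun x hx => h1 x (by unfold Search.idx; omega)
        (by unfold Search.oldVal; omega)) h2, by rw [h1 _ (by decide) (by decide), hs₃.2], h3⟩
    · have b1 : bits (scaledValue (xhat + (y' : I.Z))) ≤ β := bits_le_bits (abs_scaledValue_le _)
      have b2 : bits (scaledValue (xhat + (y : I.Z))) ≤ β := bits_le_bits (abs_scaledValue_le _)
      have hβ1 : 1 ≤ β := one_le_bits _
      refine Ensures.mono (Ensures.ifLE (C := I.d * (11 * β + 1) + 4 * β) (fun h => ?_)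
        fun h => ?_) ?_ fun _ h => h
      · simp only [AExp.eval, hn, ho] at h
        rw [if_pos h]
        refine (Search.copyArr_ensures (by decide) (by rw [hs₄.reg 0 (by omega), hd0])
          d_lt_magnitude (fun i hi => by rw [hs₄.position ⟨i, hi⟩]; exact hval _ _)).mono le_rfl ?_
        rintro s' ⟨h1, h2, h3⟩
        exact ⟨xhat + (y' : I.Z),
          fun x hx => by rw [h1 x (by unfold Search.idx; omega), hs₄.reg x hx],
          by rw [h2 _ (by decide), hs₄.gens], by rw [h2 _ (by decide), hs₄.costs],
          fun l => by rw [h3 l l.2, hs₄.position],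
          fun l => by rw [h2 _ (by decide), hs₄.position]⟩
      · simp only [AExp.eval, hn, ho] at h
        rw [if_neg h]
        exact Ensures.pure ⟨_, hs₄⟩ (by omega)
      · simp only [AExp.eval, AExp.cost, hn, ho]
        omega
    · rw [← hβ]
      omega
  · rw [← hβ]
    unfold roundCost
    omega
  · exact le_rfl

/-- The search, started in `xhat`, simulates the iterated round kernel started in `0 ∈ K`. -/
theorem mcs_simulates :
    Simulates (search S xhat isLazy ε)
      (numSamples xhat ε * (roundCost I.d (bits (magnitude S)) (tMix S xhat isLazy).toNat + 5))
      (fun y : I.K => fun s' => ∃ w, Represents (initMem S xhat isLazy ε) (xhat + (y : I.Z)) w s')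
      (Simulates.iter (roundKernel S xhat isLazy (tMix S xhat isLazy).toNat)
        (numSamples xhat ε) 0) := by
  have h3 : (initMem S xhat isLazy ε).reg 3 = (numSamples xhat ε : ℕ) := by simp [initMem]
  have hb := bits_natCast_le (numSamples xhat ε)
  have h1 : 1 ≤ numSamples xhat ε := Nat.succ_pos _
  refine (Simulates.rep (s := initMem S xhat isLazy ε) (e := Search.numSamples)
    (fun y s ⟨w, h⟩ => round_simulates y h) h3 0
    ⟨0, by simpa using represents_initMem S xhat isLazy ε⟩).mono ?_ fun _ => le_rfl
  simp only [AExp.cost, h3]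
  -- The bit length of the number of samples is paid once, and is at most linear in that number.
  rw [mul_add, mul_add]
  omega

end GroupRelaxation

end MCS

/-! ### Total variation distance and mixing -/

namespace MCS

section Mixing

variable {α : Type*} [Fintype α]

theorem vecMul_mem_stdSimplex [DecidableEq α] {P : Matrix α α ℝ}
    (hP : P ∈ rowStochastic ℝ α) {μ : α → ℝ} (hμ : μ ∈ stdSimplex ℝ α) :
    μ ᵥ* P ∈ stdSimplex ℝ α := by
  refine ⟨fun y => Finset.sum_nonneg fun x _ =>
    mul_nonneg (hμ.1 x) (nonneg_of_mem_rowStochastic hP), ?_⟩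
  simp only [vecMul, dotProduct]
  rw [Finset.sum_comm]
  simp only [← Finset.mul_sum, sum_row_of_mem_rowStochastic hP, mul_one]
  exact hμ.2

theorem tv_le_of_mem_stdSimplex {μ ν : α → ℝ} (hμ : μ ∈ stdSimplex ℝ α) :
    tv μ ν ≤ (1 / 2) * (1 + ∑ x, |ν x|) := by
  unfold tv
  refine mul_le_mul_of_nonneg_left ?_ (by norm_num)
  have h1 : ∑ x, |μ x| = 1 := by
    rw [← hμ.2]
    exact Finset.sum_congr rfl fun x _ => abs_of_nonneg (hμ.1 x)
  rw [← h1, ← Finset.sum_add_distrib]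
  exact Finset.sum_le_sum fun x _ => abs_sub _ _

theorem tv_le_distToStationary [DecidableEq α] {P : Matrix α α ℝ}
    (hP : P ∈ rowStochastic ℝ α) (π : α → ℝ) (t : ℕ) (μ : stdSimplex ℝ α) :
    tv ((μ : α → ℝ) ᵥ* (P ^ t)) π ≤ distToStationary P π t := by
  refine le_ciSup (f := fun μ : stdSimplex ℝ α => tv ((μ : α → ℝ) ᵥ* (P ^ t)) π) ?_ μ
  refine ⟨(1 / 2) * (1 + ∑ x, |π x|), ?_⟩
  rintro _ ⟨ν, rfl⟩
  exact tv_le_of_mem_stdSimplex (vecMul_mem_stdSimplex (pow_mem hP t) ν.2)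

/-- Probabilities of events differ by at most the total variation distance. -/
theorem sum_sub_sum_le_tv [DecidableEq α] {μ ν : α → ℝ} (h : ∑ x, μ x = ∑ x, ν x) (s : Finset α) :
    ∑ x ∈ s, ν x - ∑ x ∈ s, μ x ≤ tv μ ν := by
  have h1 := Finset.sum_add_sum_compl s μ
  have h2 := Finset.sum_add_sum_compl s ν
  have h3 := Finset.sum_add_sum_compl s fun x => |μ x - ν x|
  have h4 : ∑ x ∈ s, (ν x - μ x) ≤ ∑ x ∈ s, |μ x - ν x| :=
    Finset.sum_le_sum fun x _ => by rw [abs_sub_comm]; exact le_abs_self _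
  have h5 : ∑ x ∈ sᶜ, (μ x - ν x) ≤ ∑ x ∈ sᶜ, |μ x - ν x| :=
    Finset.sum_le_sum fun x _ => le_abs_self _
  rw [Finset.sum_sub_distrib] at h4 h5
  unfold tv
  linarith

theorem sum_uniform [Nonempty α] : ∑ x, uniform α x = 1 := by
  have : (Fintype.card α : ℝ) ≠ 0 := by exact_mod_cast Fintype.card_ne_zero
  simp [uniform, this]

/-- After the mixing time every set is hit with nearly its uniform probability. -/
theorem sum_uniform_sub_le_sum_row [DecidableEq α] [Nonempty α] {P : Matrix α α ℝ}
    (hP : P ∈ rowStochastic ℝ α)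
    {t : ℕ} {δ : ℝ} (ht : distToStationary P (uniform α) t ≤ δ) (x : α) (s : Finset α) :
    (s.card : ℝ) / Fintype.card α - δ ≤ ∑ y ∈ s, (P ^ t) x y := by
  have h1 := tv_le_distToStationary hP (uniform α) t ⟨Pi.single x 1, single_mem_stdSimplex ℝ x⟩
  have hrow : (Pi.single x 1 : α → ℝ) ᵥ* (P ^ t) = (P ^ t) x := Matrix.single_one_vecMul _ _
  change tv ((Pi.single x 1 : α → ℝ) ᵥ* (P ^ t)) (uniform α) ≤ _ at h1
  rw [hrow] at h1
  have h2 := sum_sub_sum_le_tv (μ := (P ^ t) x) (ν := uniform α)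
    (by rw [sum_uniform, sum_row_of_mem_rowStochastic (pow_mem hP t)]) s
  have h3 : ∑ y ∈ s, uniform α y = (s.card : ℝ) / Fintype.card α := by
    simp [uniform, div_eq_mul_inv]
  linarith

theorem mixingTime_le [DecidableEq α] {P : Matrix α α ℝ} {π : α → ℝ} {δ : ℝ} {t : ℕ}
    (h : distToStationary P π t ≤ δ) : mixingTime P π δ ≤ t :=
  iInf_le (fun t : {t : ℕ // distToStationary P π t ≤ δ} => ((t : ℕ) : ℕ∞)) ⟨t, h⟩

/-- A finite mixing time is attained. -/
theorem distToStationary_toNat_mixingTime [DecidableEq α] {P : Matrix α α ℝ} {π : α → ℝ} {δ : ℝ}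
    (h : mixingTime P π δ ≠ ⊤) : distToStationary P π (mixingTime P π δ).toNat ≤ δ := by
  have hne : Nonempty {t : ℕ // distToStationary P π t ≤ δ} := by
    by_contra hempty
    rw [not_nonempty_iff] at hempty
    exact h (by unfold mixingTime; exact iInf_of_empty _)
  obtain ⟨⟨t, ht⟩, hmin⟩ :=
    ciInf_mem (fun t : {t : ℕ // distToStationary P π t ≤ δ} => ((t : ℕ) : ℕ∞))
  have : mixingTime P π δ = (t : ℕ∞) := hmin.symm
  rw [this, ENat.toNat_natCast]
  exact ht

end Mixing

/-! ### Mixing of random walks on finite abelian groups through characters -/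

section Fourier

variable {G : Type*} [AddCommGroup G] [Fintype G] [DecidableEq G]

theorem sum_pow_mul_char {P : Matrix G G ℝ} {ψ : AddChar G ℂ} {l : ℂ}
    (hl : ∀ x, ∑ y, (P x y : ℂ) * ψ y = l * ψ x) (t : ℕ) (x : G) :
    ∑ y, ((P ^ t) x y : ℂ) * ψ y = l ^ t * ψ x := by
  induction t generalizing x with
  | zero => simp [Matrix.one_apply, apply_ite Complex.ofReal]
  | succ t ih =>
    simp only [pow_succ' P, Matrix.mul_apply, Complex.ofReal_sum, Complex.ofReal_mul,
      Finset.sum_mul]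
    rw [Finset.sum_comm]
    simp only [mul_assoc, ← Finset.mul_sum, ih]
    rw [pow_succ, mul_assoc, ← hl, Finset.mul_sum]
    exact Finset.sum_congr rfl fun y _ => by ring

theorem char_inversion (q : G → ℂ) (y : G) :
    (Fintype.card G : ℂ) * q y = ∑ ψ : AddChar G ℂ, ψ (-y) * ∑ z, q z * ψ z := by
  have h : ∀ ψ : AddChar G ℂ, ψ (-y) * ∑ z, q z * ψ z = ∑ z, q z * ψ (z - y) := fun ψ => by
    rw [Finset.mul_sum]
    refine Finset.sum_congr rfl fun z _ => ?_
    rw [sub_eq_add_neg, AddChar.map_add_eq_mul]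
    ring
  simp only [h]
  rw [Finset.sum_comm]
  simp only [← Finset.mul_sum, AddChar.sum_apply_eq_ite, sub_eq_zero]
  simp [mul_comm]

/-- A chain that is diagonalized by the characters, with all nontrivial eigenvalues of modulus at
most `ρ`, converges to uniformity at rate `ρ`. -/
theorem abs_pow_sub_uniform_le {P : Matrix G G ℝ} {l : AddChar G ℂ → ℂ} {ρ : ℝ}
    (hl : ∀ ψ : AddChar G ℂ, ∀ x, ∑ y, (P x y : ℂ) * ψ y = l ψ * ψ x) (h0 : l 0 = 1)
    (hρ0 : 0 ≤ ρ) (hρ : ∀ ψ, ψ ≠ 0 → ‖l ψ‖ ≤ ρ) (t : ℕ) (x y : G) :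
    |(P ^ t) x y - 1 / Fintype.card G| ≤ ρ ^ t := by
  have hc : (0 : ℝ) < Fintype.card G := by exact_mod_cast Fintype.card_pos
  have h1 := char_inversion (fun z => (((P ^ t) x z : ℝ) : ℂ)) y
  simp only [sum_pow_mul_char (hl _)] at h1
  rw [← Finset.add_sum_erase _ _ (Finset.mem_univ (0 : AddChar G ℂ)), h0] at h1
  simp only [AddChar.zero_apply, one_pow, mul_one] at h1
  have h2 : ‖∑ ψ ∈ Finset.univ.erase (0 : AddChar G ℂ), ψ (-y) * (l ψ ^ t * ψ x)‖ ≤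
      Fintype.card G * ρ ^ t := by
    refine (norm_sum_le _ _).trans ?_
    calc ∑ ψ ∈ Finset.univ.erase (0 : AddChar G ℂ), ‖ψ (-y) * (l ψ ^ t * ψ x)‖
        ≤ ∑ ψ ∈ Finset.univ.erase (0 : AddChar G ℂ), ρ ^ t := by
          refine Finset.sum_le_sum fun ψ hψ => ?_
          rw [norm_mul, norm_mul, AddChar.norm_apply, AddChar.norm_apply, one_mul, mul_one,
            norm_pow]
          exact pow_le_pow_left₀ (norm_nonneg _) (hρ ψ (Finset.ne_of_mem_erase hψ)) t
      _ ≤ ∑ ψ : AddChar G ℂ, ρ ^ t :=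
          Finset.sum_le_sum_of_subset_of_nonneg (Finset.erase_subset _ _)
            fun _ _ _ => pow_nonneg hρ0 t
      _ = Fintype.card G * ρ ^ t := by
          rw [Finset.sum_const, Finset.card_univ, AddChar.card_eq, nsmul_eq_mul]
  have h3 : ∑ ψ ∈ Finset.univ.erase (0 : AddChar G ℂ), ψ (-y) * (l ψ ^ t * ψ x) =
      ((Fintype.card G * ((P ^ t) x y - 1 / Fintype.card G) : ℝ) : ℂ) := by
    rw [eq_sub_of_add_eq' h1.symm]
    have : (Fintype.card G : ℂ) ≠ 0 := by exact_mod_cast hc.ne'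
    push_cast
    field_simp
  rw [h3, Complex.norm_real, norm_mul, Real.norm_of_nonneg hc.le, Real.norm_eq_abs] at h2
  exact le_of_mul_le_mul_left h2 hc

theorem distToStationary_le {P : Matrix G G ℝ} {t : ℕ} {η : ℝ}
    (h : ∀ x y, |(P ^ t) x y - 1 / Fintype.card G| ≤ η) :
    distToStationary P (uniform G) t ≤ Fintype.card G * η / 2 := by
  have : Nonempty (stdSimplex ℝ G) := ⟨⟨Pi.single 0 1, single_mem_stdSimplex ℝ 0⟩⟩
  refine ciSup_le fun μ => ?_
  obtain ⟨μ, hμ0, hμ1⟩ := μ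
  have hy : ∀ y, |(μ ᵥ* (P ^ t)) y - uniform G y| ≤ η := fun y => by
    have e : (μ ᵥ* (P ^ t)) y - uniform G y =
        ∑ x, μ x * ((P ^ t) x y - 1 / Fintype.card G) := by
      simp only [vecMul, dotProduct, uniform, mul_sub, Finset.sum_sub_distrib, ← Finset.sum_mul,
        hμ1, one_mul]
    rw [e]
    calc |∑ x, μ x * ((P ^ t) x y - 1 / Fintype.card G)|
        ≤ ∑ x, |μ x * ((P ^ t) x y - 1 / Fintype.card G)| := Finset.abs_sum_le_sum_abs _ _
      _ ≤ ∑ x, μ x * η := Finset.sum_le_sum fun x _ => by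
          rw [abs_mul, abs_of_nonneg (hμ0 x)]
          exact mul_le_mul_of_nonneg_left (h x y) (hμ0 x)
      _ = η := by rw [← Finset.sum_mul, hμ1, one_mul]
  unfold tv
  calc (1 / 2 : ℝ) * ∑ y, |(μ ᵥ* (P ^ t)) y - uniform G y|
      ≤ (1 / 2) * ∑ _y : G, η :=
        mul_le_mul_of_nonneg_left (Finset.sum_le_sum fun y _ => hy y) (by norm_num)
    _ = Fintype.card G * η / 2 := by
        rw [Finset.sum_const, Finset.card_univ, nsmul_eq_mul]
        ring

/-- A nontrivial `N`-th root of unity has real part at most `1 - 1 / (2 N²)`: otherwise all of its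
first `N` powers have positive real part, although they sum to zero. -/
theorem re_le_of_pow_eq_one {z : ℂ} {N : ℕ} (hN : 0 < N) (hz : z ^ N = 1) (hz1 : z ≠ 1) :
    z.re ≤ 1 - 1 / (2 * (N : ℝ) ^ 2) := by
  have hnorm : ‖z‖ = 1 := Complex.norm_eq_one_of_pow_eq_one hz hN.ne'
  have hN' : (0 : ℝ) < N := by exact_mod_cast hN
  have hdist : 1 / (N : ℝ) ≤ ‖1 - z‖ := by
    by_contra hlt
    rw [not_le, lt_div_iff₀ hN'] at hlt
    have hpow : ∀ i : ℕ, ‖1 - z ^ i‖ ≤ i * ‖1 - z‖ := by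
      intro i
      induction i with
      | zero => simp
      | succ i ih =>
        have e : 1 - z ^ (i + 1) = (1 - z ^ i) + z ^ i * (1 - z) := by ring
        rw [e]
        refine (norm_add_le _ _).trans ?_
        rw [norm_mul, norm_pow, hnorm, one_pow, one_mul]
        push_cast
        linarith
    have hsum : ∑ i ∈ Finset.range N, z ^ i = 0 := by
      have h := geom_sum_mul z N
      rw [hz, sub_self] at h
      exact (mul_eq_zero.1 h).resolve_right (sub_ne_zero.2 hz1)
    have hpos : 0 < ∑ i ∈ Finset.range N, (z ^ i).re := by
      refine Finset.sum_pos (fun i hi => ?_) ⟨0, Finset.mem_range.2 hN⟩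
      have hi' : (i : ℝ) ≤ N := by exact_mod_cast (Finset.mem_range.1 hi).le
      have h1 : ‖1 - z ^ i‖ < 1 := by
        refine (hpow i).trans_lt (lt_of_le_of_lt ?_ hlt)
        rw [mul_comm]
        exact mul_le_mul_of_nonneg_left hi' (norm_nonneg _)
      have h2 := (Complex.re_le_norm (1 - z ^ i)).trans_lt h1
      simp only [Complex.sub_re, Complex.one_re] at h2
      linarith
    rw [← Complex.re_sum, hsum] at hpos
    exact lt_irrefl _ hpos
  have h1 : ‖z‖ ^ 2 = z.re ^ 2 + z.im ^ 2 := by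
    rw [← Complex.normSq_eq_norm_sq, Complex.normSq_apply]
    ring
  have h2 : ‖1 - z‖ ^ 2 = (1 - z.re) ^ 2 + z.im ^ 2 := by
    rw [← Complex.normSq_eq_norm_sq, Complex.normSq_apply]
    simp only [Complex.sub_re, Complex.sub_im, Complex.one_re, Complex.one_im]
    ring
  have h3 : (1 / (N : ℝ)) ^ 2 ≤ ‖1 - z‖ ^ 2 := pow_le_pow_left₀ (by positivity) hdist 2
  rw [hnorm] at h1
  have h4 : 1 / (2 * (N : ℝ) ^ 2) = (1 / (N : ℝ)) ^ 2 / 2 := by field_simp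
  rw [h4]
  nlinarith

end Fourier

namespace GroupRelaxation

variable {m n : ℕ} {I : GroupRelaxation m n}

theorem card_K_pos (I : GroupRelaxation m n) : 0 < Nat.card I.K := Nat.card_pos

theorem KStar_nonempty (xhat : I.Z) : (I.KStar xhat).Nonempty :=
  Finite.exists_min (I.f xhat)

theorem ncard_KStar_pos (xhat : I.Z) : 0 < (I.KStar xhat).ncard :=
  (Set.ncard_pos (Set.toFinite _)).2 (KStar_nonempty xhat)

theorem ncard_KStar_le (xhat : I.Z) : (I.KStar xhat).ncard ≤ Nat.card I.K := by
  rw [← Set.ncard_univ]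
  exact Set.ncard_le_ncard (Set.subset_univ _) (Set.toFinite _)

theorem one_div_card_le_piStar (xhat : I.Z) : 1 / (Nat.card I.K : ℝ) ≤ I.piStar xhat := by
  unfold piStar
  have h : (1 : ℝ) ≤ (I.KStar xhat).ncard := by exact_mod_cast ncard_KStar_pos xhat
  exact div_le_div_of_nonneg_right h (by positivity)

theorem piStar_pos (xhat : I.Z) : 0 < I.piStar xhat :=
  div_pos (by exact_mod_cast ncard_KStar_pos xhat) (by exact_mod_cast card_K_pos I)

theorem piStar_le_one (xhat : I.Z) : I.piStar xhat ≤ 1 :=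
  div_le_one_of_le₀ (by exact_mod_cast ncard_KStar_le xhat) (by positivity)

namespace CyclicGenerators

variable (S : I.CyclicGenerators)

theorem char_eq_zero {ψ : AddChar I.K ℂ} (h : ∀ j, ψ (S.h j) = 1) : ψ = 0 := by
  ext x
  obtain ⟨a, ha⟩ := S.directSum.2 x
  dsimp only at ha
  rw [← ha, AddChar.zero_apply]
  refine Finset.sum_induction _ (fun y => ψ y = 1)
    (fun a b ha hb => by rw [AddChar.map_add_eq_mul, ha, hb, one_mul])
    (AddChar.map_zero_eq_one ψ) fun j _ => ?_
  obtain ⟨c, hc⟩ := AddSubgroup.mem_zmultiples_iff.1 (a j).2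
  rw [← hc, AddChar.map_zsmul_eq_zpow, h, _root_.one_zpow]

theorem card_K_le {u : ℕ} (hu : ∀ j, addOrderOf (S.h j) ≤ u) : Nat.card I.K ≤ u ^ S.k := by
  rw [← Nat.card_congr (Equiv.ofBijective _ S.directSum), Nat.card_pi]
  calc ∏ j, Nat.card (AddSubgroup.zmultiples (S.h j)) ≤ ∏ _j : Fin S.k, u :=
        Finset.prod_le_prod' fun j _ => by rw [Nat.card_zmultiples]; exact hu j
    _ = u ^ S.k := by simp

/-- The eigenvalue of the lazy walk for the character `ψ`. Without generators the walk does not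
move, so all eigenvalues are one. -/
noncomputable def eigenvalue (ψ : AddChar I.K ℂ) : ℝ :=
  if S.k = 0 then 1 else 1 / 2 + 1 / (2 * S.k) * ∑ j, (ψ (S.h j)).re

theorem sum_chain_mul_char (ψ : AddChar I.K ℂ) (x : I.K) :
    ∑ y, (S.chain true x y : ℂ) * ψ y = (S.eigenvalue ψ : ℂ) * ψ x := by
  have hlazy : ∀ y, S.chain true x y = 1 / 2 * ((1 : Matrix I.K I.K ℝ) x y + S.walk x y) := by
    intro y
    unfold chain
    rw [if_pos rfl, Matrix.smul_apply, Matrix.add_apply, smul_eq_mul]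
  unfold eigenvalue
  by_cases hk : S.k = 0
  · simp only [hlazy, walk_of_k_eq_zero hk, if_pos hk, Matrix.one_apply]
    simp [apply_ite Complex.ofReal, ← two_mul]
  · rw [if_neg hk]
    have hk' : (S.k : ℂ) ≠ 0 := by exact_mod_cast hk
    have hre : ∀ j, (((ψ (S.h j)).re : ℝ) : ℂ) = (ψ (S.h j) + ψ (-S.h j)) / 2 := fun j => by
      rw [AddChar.map_neg_eq_conj, Complex.re_eq_add_conj]
    have hwalk : ∑ y, (S.walk x y : ℂ) * ψ y =
        ∑ j, (1 / (2 * (S.k : ℂ))) * (ψ (x + S.h j) + ψ (x - S.h j)) := by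
      simp only [walk_apply hk, Complex.ofReal_sum, Finset.sum_mul]
      rw [Finset.sum_comm]
      refine Finset.sum_congr rfl fun j _ => ?_
      push_cast
      simp only [apply_ite Complex.ofReal, Complex.ofReal_one, Complex.ofReal_zero, mul_assoc,
        add_mul, ite_mul, one_mul, zero_mul, ← Finset.mul_sum, Finset.sum_add_distrib,
        Finset.sum_ite_eq', Finset.mem_univ, if_true]
    have hsplit : ∀ y, (S.chain true x y : ℂ) * ψ y =
        1 / 2 * (((1 : Matrix I.K I.K ℝ) x y : ℂ) * ψ y) + 1 / 2 * ((S.walk x y : ℂ) * ψ y) := by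
      intro y
      rw [hlazy]
      push_cast
      ring
    simp only [hsplit, Finset.sum_add_distrib, ← Finset.mul_sum, hwalk]
    simp only [Matrix.one_apply, apply_ite Complex.ofReal, Complex.ofReal_one,
      Complex.ofReal_zero, ite_mul, one_mul, zero_mul, Finset.sum_ite_eq, Finset.mem_univ, if_true]
    push_cast
    simp only [hre, sub_eq_add_neg, AddChar.map_add_eq_mul, ← mul_add, Finset.sum_add_distrib,
      ← Finset.mul_sum, ← Finset.sum_div]
    ring

theorem eigenvalue_zero : S.eigenvalue 0 = 1 := by
  unfold eigenvalue
  split_ifs with hk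
  · rfl
  · have hk' : (S.k : ℝ) ≠ 0 := by exact_mod_cast hk
    simp
    field_simp
    norm_num

/-- A nontrivial character is nontrivial on some generator, which gives the spectral gap. -/
theorem abs_eigenvalue_le {u : ℕ} (hu : ∀ j, addOrderOf (S.h j) ≤ u) {ψ : AddChar I.K ℂ}
    (hψ : ψ ≠ 0) : |S.eigenvalue ψ| ≤ 1 - 1 / (4 * S.k * (u : ℝ) ^ 2) := by
  obtain ⟨j, hj⟩ : ∃ j, ψ (S.h j) ≠ 1 := by
    by_contra! h
    exact hψ (S.char_eq_zero h)
  have hk : S.k ≠ 0 := fun h => by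
    have := j.2
    omega
  have hk' : (0 : ℝ) < S.k := by exact_mod_cast Nat.pos_of_ne_zero hk
  have habs : ∀ i, |(ψ (S.h i)).re| ≤ 1 := fun i => by
    rw [← AddChar.norm_apply ψ (S.h i)]
    exact Complex.abs_re_le_norm _
  have hord : 0 < addOrderOf (S.h j) := addOrderOf_pos _
  have hu0 : (0 : ℝ) < u := by exact_mod_cast hord.trans_le (hu j)
  have hre : (ψ (S.h j)).re ≤ 1 - 1 / (2 * (u : ℝ) ^ 2) := by
    refine (re_le_of_pow_eq_one hord ?_ hj).trans ?_
    · rw [← AddChar.map_nsmul_eq_pow, addOrderOf_nsmul_eq_zero, AddChar.map_zero_eq_one]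
    · have h1 : ((addOrderOf (S.h j) : ℕ) : ℝ) ≤ u := by exact_mod_cast hu j
      have h0 : (0 : ℝ) < (addOrderOf (S.h j) : ℕ) := by exact_mod_cast hord
      gcongr
  have hlow : -(S.k : ℝ) ≤ ∑ i, (ψ (S.h i)).re := by
    calc -(S.k : ℝ) = ∑ _i : Fin S.k, (-1 : ℝ) := by simp
      _ ≤ _ := Finset.sum_le_sum fun i _ => (abs_le.1 (habs i)).1
  have hup : ∑ i, (ψ (S.h i)).re ≤ S.k - 1 / (2 * (u : ℝ) ^ 2) := by
    rw [← Finset.add_sum_erase _ _ (Finset.mem_univ j)]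
    have : ∑ i ∈ Finset.univ.erase j, (ψ (S.h i)).re ≤ (S.k : ℝ) - 1 := by
      calc ∑ i ∈ Finset.univ.erase j, (ψ (S.h i)).re ≤ ∑ i ∈ Finset.univ.erase j, (1 : ℝ) :=
            Finset.sum_le_sum fun i _ => (abs_le.1 (habs i)).2
        _ = (S.k : ℝ) - 1 := by
            rw [Finset.sum_const, Finset.card_erase_of_mem (Finset.mem_univ j), Finset.card_univ,
              Fintype.card_fin, nsmul_eq_mul, mul_one, Nat.cast_sub (by omega), Nat.cast_one]
    linarith
  unfold eigenvalue
  rw [if_neg hk]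
  have h1 : 1 / (2 * (S.k : ℝ)) * -(S.k : ℝ) ≤ 1 / (2 * S.k) * ∑ i, (ψ (S.h i)).re :=
    mul_le_mul_of_nonneg_left hlow (by positivity)
  have h2 : 1 / (2 * (S.k : ℝ)) * ∑ i, (ψ (S.h i)).re ≤
      1 / (2 * (S.k : ℝ)) * (S.k - 1 / (2 * (u : ℝ) ^ 2)) :=
    mul_le_mul_of_nonneg_left hup (by positivity)
  have e1 : 1 / (2 * (S.k : ℝ)) * -(S.k : ℝ) = -(1 / 2) := by field_simp
  have e2 : 1 / (2 * (S.k : ℝ)) * (S.k - 1 / (2 * (u : ℝ) ^ 2)) =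
      1 / 2 - 1 / (4 * S.k * (u : ℝ) ^ 2) := by
    field_simp
    ring
  rw [abs_of_nonneg (by linarith)]
  linarith

/-- The time `8 k² u³` suffices: the distance to uniformity is at most
`|K| (1 - 1 / (4 k u²)) ^ t / 2`, where `|K| ≤ u ^ k ≤ exp (k u)`. -/
theorem tMix_lazy_le {u : ℕ} (hu : ∀ j, addOrderOf (S.h j) ≤ u) (xhat : I.Z) :
    tMix S xhat true ≤ ((8 * S.k ^ 2 * u ^ 3 : ℕ) : ℕ∞) := by
  refine mixingTime_le ?_
  have hcard : (Fintype.card I.K : ℝ) = Nat.card I.K := by rw [Nat.card_eq_fintype_card]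
  have hc0 : (0 : ℝ) < Nat.card I.K := by exact_mod_cast card_K_pos I
  set t := 8 * S.k ^ 2 * u ^ 3 with ht
  set ρ : ℝ := 1 - 1 / (4 * S.k * (u : ℝ) ^ 2) with hρ
  have hρ0 : 0 ≤ ρ := by
    rw [hρ, sub_nonneg]
    rcases Nat.eq_zero_or_pos (S.k * u) with h | h
    -- Without generators the quotient is `1 / 0 = 0`; then `t = 0`, and `|K| = 1`.
    · rcases mul_eq_zero.1 h with h | h <;> simp [h]
    · have h1 : 1 ≤ S.k := Nat.pos_of_mul_pos_right h
      have h2 : 1 ≤ u := Nat.pos_of_mul_pos_left h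
      have h3 : 1 ≤ 4 * S.k * u ^ 2 := Nat.mul_pos (by omega) (by positivity)
      exact div_le_one_of_le₀ (by exact_mod_cast h3) (by positivity)
  have hpow : (Nat.card I.K : ℝ) ^ 2 * ρ ^ t ≤ 1 := by
    have h1 : (Nat.card I.K : ℝ) ≤ Real.exp (S.k * u) := by
      calc (Nat.card I.K : ℝ) ≤ (u : ℝ) ^ S.k := by exact_mod_cast S.card_K_le hu
        _ ≤ Real.exp u ^ S.k := pow_le_pow_left₀ (by positivity)
            (by linarith [Real.add_one_le_exp (u : ℝ)]) _
        _ = Real.exp (S.k * u) := by rw [← Real.exp_nat_mul]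
    have h2 : ρ ^ t ≤ Real.exp (-(2 * (S.k * u))) := by
      calc ρ ^ t ≤ Real.exp (-(1 / (4 * S.k * (u : ℝ) ^ 2))) ^ t :=
            pow_le_pow_left₀ hρ0 (by
              have := Real.add_one_le_exp (-(1 / (4 * S.k * (u : ℝ) ^ 2)))
              linarith) _
        _ = Real.exp (-(2 * (S.k * u))) := by
            rw [← Real.exp_nat_mul, ht]
            congr 1
            rcases Nat.eq_zero_or_pos S.k with h | h
            · simp [h]
            rcases Nat.eq_zero_or_pos u with h' | h'
            · simp [h']
            have h3 : (S.k : ℝ) ≠ 0 := by exact_mod_cast h.ne'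
            have h4 : (u : ℝ) ≠ 0 := by exact_mod_cast h'.ne'
            push_cast
            field_simp
            norm_num
    calc (Nat.card I.K : ℝ) ^ 2 * ρ ^ t
        ≤ Real.exp (S.k * u) ^ 2 * Real.exp (-(2 * (S.k * u))) :=
          mul_le_mul (pow_le_pow_left₀ hc0.le h1 2) h2 (pow_nonneg hρ0 _) (by positivity)
      _ = 1 := by
          rw [← Real.exp_nat_mul, ← Real.exp_add]
          simp
  have hdist := distToStationary_le (P := S.chain true) (t := t) (η := ρ ^ t)
    (abs_pow_sub_uniform_le (l := fun ψ => (S.eigenvalue ψ : ℂ)) S.sum_chain_mul_char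
      (by rw [S.eigenvalue_zero, Complex.ofReal_one]) hρ0
      (fun ψ hψ => by
        rw [Complex.norm_real, Real.norm_eq_abs]
        exact S.abs_eigenvalue_le hu hψ) t)
  refine hdist.trans ?_
  rw [hcard]
  have hpi := one_div_card_le_piStar xhat
  have h5 : (Nat.card I.K : ℝ) * ρ ^ t ≤ 1 / Nat.card I.K := by
    rw [le_div_iff₀ hc0]
    calc (Nat.card I.K : ℝ) * ρ ^ t * Nat.card I.K = (Nat.card I.K : ℝ) ^ 2 * ρ ^ t := by ring
      _ ≤ 1 := hpow
  linarith

end CyclicGenerators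

end GroupRelaxation

end MCS

/-! ### Optimal solutions of the group relaxation -/

namespace MCS

namespace GroupRelaxation

variable {m n : ℕ} (I : GroupRelaxation m n)

theorem inv_U_mul : I.U⁻¹ * I.U = 1 := Matrix.nonsing_inv_mul _ I.U_unimodular

theorem mul_inv_U : I.U * I.U⁻¹ = 1 := Matrix.mul_nonsing_inv _ I.U_unimodular

theorem mul_inv_V : I.V * I.V⁻¹ = 1 := Matrix.mul_nonsing_inv _ I.V_unimodular

theorem isUnit_det_basisMatrixQ : IsUnit (I.basisMatrixQ I.B I.card_B).det := by
  have h : (I.basisMatrixQ I.B I.card_B).det = ((I.basisMatrix I.B I.card_B).det : ℚ) :=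
    ((Int.castRingHom ℚ).map_det (I.basisMatrix I.B I.card_B)).symm
  rw [isUnit_iff_ne_zero, h]
  exact_mod_cast I.optimal.det_ne_zero

theorem dualB_vecMul :
    I.dualB I.B I.card_B ᵥ* I.basisMatrixQ I.B I.card_B =
      fun i => (I.costB I.B I.card_B i : ℚ) := by
  unfold ILP.dualB
  rw [Matrix.vecMul_vecMul, Matrix.nonsing_inv_mul _ I.isUnit_det_basisMatrixQ, Matrix.vecMul_one]

theorem reducedCost_of_mem {j : Fin n} (hj : j ∈ I.B) : I.reducedCost I.B I.card_B j = 0 := by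
  obtain ⟨i, rfl⟩ : ∃ i, I.B.orderEmbOfFin I.card_B i = j := by
    have : j ∈ Set.range (I.B.orderEmbOfFin I.card_B) := by
      rw [Finset.range_orderEmbOfFin]; exact hj
    exact this
  have h := congrFun I.dualB_vecMul i
  unfold ILP.reducedCost
  rw [sub_eq_zero]
  exact h.symm

/-- On solutions of `A x = b` the objective is a nonnegative combination of the nonbasic
variables, up to a constant. -/
theorem cost_eq_reducedCost {x : Fin n → ℤ} (hx : I.A *ᵥ x = I.b) :
    ((I.c ⬝ᵥ x : ℤ) : ℚ) = ∑ j, I.reducedCost I.B I.card_B j * x j + I.shift := by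
  have h1 : ∀ i, (I.b i : ℚ) = ∑ j, (I.A i j : ℚ) * x j := fun i => by
    rw [← hx]
    simp [Matrix.mulVec, dotProduct]
  unfold ILP.reducedCost shift
  simp only [dotProduct, h1, sub_mul, Finset.sum_sub_distrib, Finset.sum_mul, Finset.mul_sum]
  rw [Finset.sum_comm]
  push_cast
  simp only [mul_assoc]
  ring

theorem mem_keptCols {j : Fin n} :
    j ∈ I.keptCols ↔ j ∉ I.B ∧ ¬ ∀ i, (I.r i : ℤ) ∣ (I.U⁻¹ * I.A) i j := by
  classical
  unfold keptCols
  simp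

theorem col_mem (l : Fin I.d) : I.col l ∈ I.keptCols := Finset.orderEmbOfFin_mem _ _ _

theorem sum_col {M : Type*} [AddCommMonoid M] (g : Fin n → M) :
    ∑ l, g (I.col l) = ∑ j ∈ I.keptCols, g j := by
  have h := Finset.sum_map Finset.univ I.col.toEmbedding g
  have h2 : Finset.univ.map I.col.toEmbedding = I.keptCols :=
    Finset.map_orderEmbOfFin_univ I.keptCols rfl
  rw [h2] at h
  exact h.symm

theorem exists_col_eq {j : Fin n} (hj : j ∈ I.keptCols) : ∃ l, I.col l = j := by
  have : j ∈ Set.range (I.keptCols.orderEmbOfFin rfl) := by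
    rw [Finset.range_orderEmbOfFin]
    exact hj
  exact this

/-- The columns that are dropped, and the basic ones, vanish modulo `R ℤᵐ`. -/
theorem dvd_of_notMem_keptCols {j : Fin n} (hj : j ∉ I.keptCols) (i : Fin m) :
    (I.r i : ℤ) ∣ (I.U⁻¹ * I.A) i j := by
  by_cases hB : j ∈ I.B
  · obtain ⟨k, rfl⟩ : ∃ k, I.B.orderEmbOfFin I.card_B k = j := by
      have : j ∈ Set.range (I.B.orderEmbOfFin I.card_B) := by
        rw [Finset.range_orderEmbOfFin]; exact hB
      exact this
    have h1 : I.U⁻¹ * I.basisMatrix I.B I.card_B =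
        Matrix.diagonal (fun i => (I.r i : ℤ)) * I.V := by
      rw [I.smith, ← Matrix.mul_assoc, ← Matrix.mul_assoc, inv_U_mul, Matrix.one_mul]
    have h2 := congrFun (congrFun h1 i) k
    rw [Matrix.diagonal_mul] at h2
    have h3 : (I.U⁻¹ * I.basisMatrix I.B I.card_B) i k =
        (I.U⁻¹ * I.A) i (I.B.orderEmbOfFin I.card_B k) := rfl
    rw [← h3, h2]
    exact dvd_mul_right _ _
  · by_contra h
    exact hj (I.mem_keptCols.2 ⟨hB, fun hall => h (hall i)⟩)

theorem constraintHom_intCast (v : Fin I.d → ℤ) (i : Fin m) :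
    I.constraintHom (fun l => (v l : ZMod I.rTop)) i =
      ((∑ l, I.coeff i l * v l : ℤ) : ZMod (I.r i)) := by
  change ∑ l, (I.coeff i l : ZMod (I.r i)) *
    ZMod.castHom (I.r_dvd_rTop i) (ZMod (I.r i)) (v l : ZMod I.rTop) = _
  simp only [map_intCast]
  push_cast
  rfl

/-- Solutions of the group relaxation reduce to feasible residue vectors. -/
theorem isFeasible_of_mem {x : Fin n → ℤ} (hx : I.A *ᵥ x = I.b) :
    I.IsFeasible fun l => (x (I.col l) : ZMod I.rTop) := by
  intro i
  rw [constraintHom_intCast, ZMod.intCast_eq_intCast_iff_dvd_sub]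
  have h1 : I.rhs i = ∑ j, (I.U⁻¹ * I.A) i j * x j := by
    unfold rhs
    rw [← hx, Matrix.mulVec_mulVec]
    rfl
  have h2 : ∑ l, I.coeff i l * x (I.col l) = ∑ j ∈ I.keptCols, (I.U⁻¹ * I.A) i j * x j :=
    I.sum_col fun j => (I.U⁻¹ * I.A) i j * x j
  rw [h1, h2, ← Finset.sum_add_sum_compl I.keptCols, add_sub_cancel_left]
  exact Finset.dvd_sum fun j hj =>
    Dvd.dvd.mul_right (I.dvd_of_notMem_keptCols (Finset.mem_compl.1 hj) i) _

theorem isFeasible_iff (z : I.Z) :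
    I.IsFeasible z ↔ ∀ i, (I.r i : ℤ) ∣ I.rhs i - ∑ l, I.coeff i l * ((z l).val : ℤ) := by
  have hz : z = fun l => (((z l).val : ℤ) : ZMod I.rTop) := by
    funext l
    simp
  refine forall_congr' fun i => ?_
  conv_lhs => rw [hz]
  rw [constraintHom_intCast, ZMod.intCast_eq_intCast_iff_dvd_sub]

/-- A feasible residue vector extends to a solution of the group relaxation in which the dropped
variables are zero: the basic variables are `A_B⁻¹ (b - A_N x_N)`, which is integral because
`U⁻¹ (b - A_N x_N)` lies in `R ℤᵐ`. -/
theorem exists_extension {z : I.Z} (hz : I.IsFeasible z) :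
    ∃ x ∈ I.groupFeasible I.B, (∀ l, x (I.col l) = ((z l).val : ℤ)) ∧
      ∀ j, j ∉ I.B → j ∉ I.keptCols → x j = 0 := by
  classical
  rw [isFeasible_iff] at hz
  choose t ht using hz
  obtain ⟨y, hy⟩ : ∃ y : Fin m → ℤ, y = I.V⁻¹ *ᵥ t := ⟨_, rfl⟩
  set x : Fin n → ℤ := fun j => (∑ l, if j = I.col l then ((z l).val : ℤ) else 0) +
    ∑ i, if j = I.B.orderEmbOfFin I.card_B i then y i else 0 with hx
  have hcolB : ∀ l i, I.col l ≠ I.B.orderEmbOfFin I.card_B i := fun l i h =>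
    (I.mem_keptCols.1 (I.col_mem l)).1 (h ▸ Finset.orderEmbOfFin_mem _ _ _)
  have hcol : ∀ l, x (I.col l) = ((z l).val : ℤ) := fun l => by
    simp [hx, hcolB, I.col.injective.eq_iff]
  have hother : ∀ j, j ∉ I.B → j ∉ I.keptCols → x j = 0 := fun j hB hj => by
    have h1 : ∀ l, j ≠ I.col l := fun l h => hj (h ▸ I.col_mem l)
    have h2 : ∀ i, j ≠ I.B.orderEmbOfFin I.card_B i := fun i h =>
      hB (h ▸ Finset.orderEmbOfFin_mem _ _ _)
    simp [hx, h1, h2]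
  refine ⟨x, ⟨?_, fun j hj => ?_⟩, hcol, hother⟩
  · have hb : I.basisMatrix I.B I.card_B *ᵥ y = I.U *ᵥ (fun i => (I.r i : ℤ) * t i) := by
      rw [I.smith, hy, Matrix.mulVec_mulVec, Matrix.mul_assoc, mul_inv_V, Matrix.mul_one,
        ← Matrix.mulVec_mulVec]
      congr 1
      funext i
      exact Matrix.mulVec_diagonal _ _ _
    have hcoeff : I.coeff *ᵥ (fun l => ((z l).val : ℤ)) =
        I.U⁻¹ *ᵥ (fun i => ∑ l, I.A i (I.col l) * ((z l).val : ℤ)) := by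
      have : (fun i => ∑ l, I.A i (I.col l) * ((z l).val : ℤ)) =
          I.A.submatrix id I.col *ᵥ (fun l => ((z l).val : ℤ)) := rfl
      rw [this, Matrix.mulVec_mulVec]
      rfl
    have hrt : (fun i => (I.r i : ℤ) * t i) =
        I.U⁻¹ *ᵥ (I.b - fun i => ∑ l, I.A i (I.col l) * ((z l).val : ℤ)) := by
      rw [Matrix.mulVec_sub, ← hcoeff]
      funext i
      rw [← ht]
      rfl
    rw [hrt, Matrix.mulVec_mulVec, mul_inv_U, Matrix.one_mulVec] at hb
    funext i
    have hbi := congrFun hb i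
    have e1 : (I.basisMatrix I.B I.card_B *ᵥ y) i =
        ∑ k, I.A i (I.B.orderEmbOfFin I.card_B k) * y k := rfl
    rw [e1, Pi.sub_apply] at hbi
    have e2 : (I.A *ᵥ x) i = ∑ l, I.A i (I.col l) * ((z l).val : ℤ) +
        ∑ k, I.A i (I.B.orderEmbOfFin I.card_B k) * y k := by
      simp only [Matrix.mulVec, dotProduct, hx, mul_add, Finset.sum_add_distrib, Finset.mul_sum]
      congr 1 <;>
      · rw [Finset.sum_comm]
        simp
    rw [e2, hbi]
    ring
  · by_cases hk : j ∈ I.keptCols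
    · obtain ⟨l, rfl⟩ := I.exists_col_eq hk
      rw [hcol]
      positivity
    · rw [hother j hj hk]

/-- The reduced objective underestimates the objective of all solutions of the group relaxation,
because the reduced costs and the nonbasic variables are nonnegative. -/
theorem value_le_cost {x : Fin n → ℤ} (hx : x ∈ I.groupFeasible I.B) :
    I.value (fun l => (x (I.col l) : ZMod I.rTop)) ≤ ((I.c ⬝ᵥ x : ℤ) : ℚ) := by
  rw [I.cost_eq_reducedCost hx.1]
  unfold value
  refine add_le_add_left ?_ _
  have hnn : ∀ j, 0 ≤ I.reducedCost I.B I.card_B j * x j := fun j => by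
    by_cases hj : j ∈ I.B
    · rw [I.reducedCost_of_mem hj, zero_mul]
    · exact mul_nonneg (I.optimal.dual_feasible j) (by exact_mod_cast hx.2 j hj)
  calc ∑ l, I.cost l * (((x (I.col l) : ZMod I.rTop)).val : ℚ)
      ≤ ∑ l, I.reducedCost I.B I.card_B (I.col l) * x (I.col l) := by
        refine Finset.sum_le_sum fun l _ => ?_
        refine mul_le_mul_of_nonneg_left ?_ (I.optimal.dual_feasible _)
        have h0 : 0 ≤ x (I.col l) := hx.2 _ (I.mem_keptCols.1 (I.col_mem l)).1
        have h1 : (((x (I.col l) : ZMod I.rTop)).val : ℤ) ≤ x (I.col l) := by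
          rw [ZMod.val_intCast]
          have h2 := Int.emod_add_mul_ediv (x (I.col l)) I.rTop
          have h3 : 0 ≤ (I.rTop : ℤ) * (x (I.col l) / I.rTop) := by positivity
          omega
        exact_mod_cast h1
    _ = ∑ j ∈ I.keptCols, I.reducedCost I.B I.card_B j * x j :=
        I.sum_col fun j => I.reducedCost I.B I.card_B j * x j
    _ ≤ ∑ j, I.reducedCost I.B I.card_B j * x j :=
        Finset.sum_le_sum_of_subset_of_nonneg (Finset.subset_univ _) fun j _ _ => hnn j

theorem cost_eq_value {z : I.Z} {x : Fin n → ℤ} (hx : I.A *ᵥ x = I.b)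
    (hcol : ∀ l, x (I.col l) = ((z l).val : ℤ))
    (hother : ∀ j, j ∉ I.B → j ∉ I.keptCols → x j = 0) :
    ((I.c ⬝ᵥ x : ℤ) : ℚ) = I.value z := by
  rw [I.cost_eq_reducedCost hx]
  unfold value
  congr 1
  have h : ∑ l, I.cost l * ((z l).val : ℚ) =
      ∑ l, I.reducedCost I.B I.card_B (I.col l) * x (I.col l) :=
    Finset.sum_congr rfl fun l _ => by rw [hcol]; rfl
  rw [h, I.sum_col fun j => I.reducedCost I.B I.card_B j * x j]
  symm
  refine Finset.sum_subset (Finset.subset_univ _) fun j _ hj => ?_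
  by_cases hB : j ∈ I.B
  · rw [I.reducedCost_of_mem hB, zero_mul]
  · rw [hother j hB hj, Int.cast_zero, mul_zero]

variable {I}

theorem IsFeasible.add_mem {xhat : I.Z} (h : I.IsFeasible xhat) (y : I.K) :
    I.IsFeasible (xhat + (y : I.Z)) := by
  intro i
  have hy : I.constraintHom (y : I.Z) = 0 := y.2
  rw [map_add, hy, add_zero, h i]

theorem IsFeasible.sub_mem {xhat z : I.Z} (h : I.IsFeasible xhat) (hz : I.IsFeasible z) :
    z - xhat ∈ I.K := by
  change I.constraintHom (z - xhat) = 0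
  rw [map_sub, sub_eq_zero]
  funext i
  rw [hz i, h i]

/-- Minimizers of the reduced objective solve the group relaxation. -/
theorem solves_of_mem_KStar {xhat : I.Z} (h : I.IsFeasible xhat) {y : I.K}
    (hy : y ∈ I.KStar xhat) : I.Solves fun l => (((xhat + (y : I.Z)) l).val : ℤ) := by
  obtain ⟨x, hx, hcol, hother⟩ := I.exists_extension (h.add_mem y)
  refine ⟨x, ⟨hx, fun x' hx' => ?_⟩, hcol, hother⟩
  have h1 := I.cost_eq_value hx.1 hcol hother
  have h2 := I.value_le_cost hx'
  have h3 := hy ⟨_, h.sub_mem (I.isFeasible_of_mem hx'.1)⟩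
  unfold f at h3
  dsimp only at h3
  rw [add_sub_cancel] at h3
  rw [← h1] at h3
  exact_mod_cast h3.trans h2

/-! ### The integral objective of the program -/

variable (I)

theorem abs_det_pos : 0 < |(I.basisMatrix I.B I.card_B).det| :=
  abs_pos.2 I.optimal.det_ne_zero

/-- `sign (det A_B) c_B adj(A_B) = |det A_B| y` for the dual solution `y`. -/
theorem sign_mul_vecMul_adjugate (i : Fin m) :
    (((I.basisMatrix I.B I.card_B).det.sign *
      (I.costB I.B I.card_B ᵥ* (I.basisMatrix I.B I.card_B).adjugate) i : ℤ) : ℚ) =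
      (|(I.basisMatrix I.B I.card_B).det| : ℤ) * I.dualB I.B I.card_B i := by
  have hdet : (I.basisMatrixQ I.B I.card_B).det = ((I.basisMatrix I.B I.card_B).det : ℚ) :=
    ((Int.castRingHom ℚ).map_det (I.basisMatrix I.B I.card_B)).symm
  have hadj : (I.basisMatrixQ I.B I.card_B).adjugate =
      (I.basisMatrix I.B I.card_B).adjugate.map (Int.cast : ℤ → ℚ) :=
    ((Int.castRingHom ℚ).map_adjugate (I.basisMatrix I.B I.card_B)).symm
  have h0 : ((I.basisMatrix I.B I.card_B).det : ℚ) ≠ 0 := by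
    exact_mod_cast I.optimal.det_ne_zero
  have h1 : (|(I.basisMatrix I.B I.card_B).det| : ℤ) = (I.basisMatrix I.B I.card_B).det.sign *
      (I.basisMatrix I.B I.card_B).det := by
    rw [Int.sign_mul_self, Int.abs_eq_natAbs]
  unfold ILP.dualB
  rw [Matrix.inv_def, hdet, hadj, h1, Ring.inverse_eq_inv, Matrix.vecMul_smul, Pi.smul_apply,
    smul_eq_mul]
  rw [Int.cast_mul, Int.cast_mul, mul_assoc, mul_inv_cancel_left₀ h0]
  congr 1
  simp [vecMul, dotProduct]

theorem scaledShift_eq :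
    (I.scaledShift : ℚ) = (|(I.basisMatrix I.B I.card_B).det| : ℤ) * I.shift := by
  unfold scaledShift shift
  simp only [dotProduct, Finset.mul_sum, ← mul_assoc]
  rw [Int.cast_sum]
  refine Finset.sum_congr rfl fun i _ => ?_
  rw [Int.cast_mul, sign_mul_vecMul_adjugate]

theorem scaledCost_eq (l : Fin I.d) :
    (I.scaledCost l : ℚ) = (|(I.basisMatrix I.B I.card_B).det| : ℤ) * I.cost l := by
  unfold scaledCost cost ILP.reducedCost
  simp only [dotProduct, Finset.mul_sum, mul_sub, ← mul_assoc]
  rw [Int.cast_sub, Int.cast_sum, Int.cast_mul]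
  congr 1
  refine Finset.sum_congr rfl fun i _ => ?_
  rw [Int.cast_mul, sign_mul_vecMul_adjugate]

theorem scaledValue_eq (z : I.Z) :
    (scaledValue z : ℚ) = (|(I.basisMatrix I.B I.card_B).det| : ℤ) * I.value z := by
  unfold scaledValue value
  rw [Int.cast_add, scaledShift_eq, Int.cast_sum, mul_add, Finset.mul_sum, add_comm]
  congr 1
  refine Finset.sum_congr rfl fun l _ => ?_
  rw [Int.cast_mul, scaledCost_eq, mul_assoc, Int.cast_natCast]

theorem scaledValue_le_iff (z z' : I.Z) :
    scaledValue z ≤ scaledValue z' ↔ I.value z ≤ I.value z' := by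
  have h : (0 : ℚ) < (|(I.basisMatrix I.B I.card_B).det| : ℤ) := by exact_mod_cast I.abs_det_pos
  rw [← Int.cast_le (R := ℚ), scaledValue_eq, scaledValue_eq, mul_le_mul_iff_right₀ h]

end GroupRelaxation

end MCS

/-! ### Bit lengths of the data -/

namespace MCS

theorem natAbs_le_two_pow {z : ℤ} {L : ℕ} (h : 1 + Nat.log 2 z.natAbs ≤ L) : z.natAbs ≤ 2 ^ L :=
  (Nat.lt_pow_succ_log_self Nat.one_lt_two _).le.trans
    (Nat.pow_le_pow_right Nat.two_pos (by omega))

theorem natAbs_sum_le {ι : Type*} (s : Finset ι) (g : ι → ℤ) {C : ℕ}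
    (h : ∀ i ∈ s, (g i).natAbs ≤ C) : (∑ i ∈ s, g i).natAbs ≤ s.card * C :=
  (Int.natAbs_sum_le s g).trans ((Finset.sum_le_card_nsmul s _ C h).trans_eq (smul_eq_mul _ _))

theorem natAbs_det_le {m n L : ℕ} (hm : m ≤ n) {M : Matrix (Fin m) (Fin m) ℤ}
    (h : ∀ i j, (M i j).natAbs ≤ 2 ^ L) : M.det.natAbs ≤ 2 ^ (n ^ 2 + n * L) := by
  have h1 := Matrix.det_le (abv := AbsoluteValue.abs) (A := M) (x := ((2 ^ L : ℕ) : ℤ))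
    fun i j => by
      rw [AbsoluteValue.abs_apply, Int.abs_eq_natAbs]
      exact_mod_cast h i j
  rw [AbsoluteValue.abs_apply, Int.abs_eq_natAbs, Fintype.card_fin, nsmul_eq_mul] at h1
  have h2 : M.det.natAbs ≤ m.factorial * (2 ^ L) ^ m := by exact_mod_cast h1
  have h3 : m.factorial ≤ 2 ^ (n ^ 2) :=
    calc m.factorial ≤ m ^ m := Nat.factorial_le_pow m
      _ ≤ (2 ^ m) ^ m := Nat.pow_le_pow_left Nat.lt_two_pow_self.le m
      _ = 2 ^ (m * m) := (pow_mul _ _ _).symm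
      _ ≤ 2 ^ (n ^ 2) := Nat.pow_le_pow_right Nat.two_pos (by rw [sq]; exact Nat.mul_le_mul hm hm)
  have h4 : (2 ^ L) ^ m ≤ 2 ^ (n * L) := by
    rw [← pow_mul]
    exact Nat.pow_le_pow_right Nat.two_pos (by rw [mul_comm]; exact Nat.mul_le_mul_right _ hm)
  calc M.det.natAbs ≤ m.factorial * (2 ^ L) ^ m := h2
    _ ≤ 2 ^ (n ^ 2) * 2 ^ (n * L) := Nat.mul_le_mul h3 h4
    _ = _ := (pow_add _ _ _).symm

namespace GroupRelaxation

variable {m n : ℕ} (I : GroupRelaxation m n)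

theorem natAbs_A_le (i : Fin m) (j : Fin n) : (I.A i j).natAbs ≤ 2 ^ I.inputLength := by
  refine natAbs_le_two_pow ?_
  have h1 := Finset.single_le_sum (f := fun j => 1 + Nat.log 2 (I.A i j).natAbs)
    (fun _ _ => Nat.zero_le _) (Finset.mem_univ j)
  have h2 := Finset.single_le_sum (f := fun i => ∑ j, (1 + Nat.log 2 (I.A i j).natAbs))
    (fun _ _ => Nat.zero_le _) (Finset.mem_univ i)
  unfold ILP.inputLength
  omega

theorem natAbs_b_le (i : Fin m) : (I.b i).natAbs ≤ 2 ^ I.inputLength := by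
  refine natAbs_le_two_pow ?_
  have h1 := Finset.single_le_sum (f := fun i => 1 + Nat.log 2 (I.b i).natAbs)
    (fun _ _ => Nat.zero_le _) (Finset.mem_univ i)
  unfold ILP.inputLength
  omega

theorem natAbs_c_le (j : Fin n) : (I.c j).natAbs ≤ 2 ^ I.inputLength := by
  refine natAbs_le_two_pow ?_
  have h1 := Finset.single_le_sum (f := fun j => 1 + Nat.log 2 (I.c j).natAbs)
    (fun _ _ => Nat.zero_le _) (Finset.mem_univ j)
  unfold ILP.inputLength
  omega

theorem m_le_n (I : GroupRelaxation m n) : m ≤ n := by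
  have h := Finset.card_le_univ I.B
  rwa [I.card_B, Fintype.card_fin] at h

theorem d_le_n : I.d ≤ n := by
  have h := Finset.card_le_univ I.keptCols
  rwa [Fintype.card_fin] at h

/-- Exponent of a bound for the minors of `A`. -/
def detBits (n L : ℕ) : ℕ := n ^ 2 + n * L

theorem natAbs_det_basisMatrix_le :
    (I.basisMatrix I.B I.card_B).det.natAbs ≤ 2 ^ detBits n I.inputLength :=
  natAbs_det_le I.m_le_n fun i _ => I.natAbs_A_le i _

theorem natAbs_adjugate_le (i j : Fin m) :
    ((I.basisMatrix I.B I.card_B).adjugate i j).natAbs ≤ 2 ^ detBits n I.inputLength := by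
  rw [Matrix.adjugate_apply]
  refine natAbs_det_le I.m_le_n fun k l => ?_
  rw [Matrix.updateRow_apply]
  split_ifs with h
  · rw [Pi.single_apply]
    split_ifs
    · exact Nat.one_le_two_pow
    · exact Nat.zero_le _
  · exact I.natAbs_A_le k _

/-- The last invariant factor divides the determinant of the basis. -/
theorem rTop_le : I.rTop ≤ 2 ^ detBits n I.inputLength := by
  refine le_trans (Nat.le_of_dvd ?_ ?_) I.natAbs_det_basisMatrix_le
  · exact Int.natAbs_pos.2 I.optimal.det_ne_zero
  · rw [I.smith, Matrix.det_mul, Matrix.det_mul, Matrix.det_diagonal, Int.natAbs_mul,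
      Int.natAbs_mul, Int.isUnit_iff_natAbs_eq.1 I.U_unimodular,
      Int.isUnit_iff_natAbs_eq.1 I.V_unimodular, one_mul, mul_one]
    rw [← Int.natCast_dvd_natCast, Int.dvd_natAbs]
    exact Finset.dvd_prod_of_mem (fun i => (I.r i : ℤ)) (Finset.mem_univ _)

theorem natAbs_sign_mul_dot_le (v : Fin m → ℤ) (hv : ∀ i, (v i).natAbs ≤ 2 ^ I.inputLength) :
    ((I.basisMatrix I.B I.card_B).det.sign *
      ((I.costB I.B I.card_B ᵥ* (I.basisMatrix I.B I.card_B).adjugate) ⬝ᵥ v)).natAbs ≤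
      2 ^ (2 * n + 2 * I.inputLength + detBits n I.inputLength) := by
  set L := I.inputLength with hL
  set e := detBits n L with he
  have hm : m ≤ 2 ^ n := I.m_le_n.trans Nat.lt_two_pow_self.le
  have h1 : ∀ i, ((I.costB I.B I.card_B ᵥ* (I.basisMatrix I.B I.card_B).adjugate) i).natAbs ≤
      m * (2 ^ L * 2 ^ e) := fun i => by
    have h := natAbs_sum_le (C := 2 ^ L * 2 ^ e) Finset.univ
      (fun j => I.costB I.B I.card_B j * (I.basisMatrix I.B I.card_B).adjugate j i) fun j _ => by
        rw [Int.natAbs_mul]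
        exact Nat.mul_le_mul (I.natAbs_c_le _) (I.natAbs_adjugate_le _ _)
    rwa [Finset.card_fin] at h
  rw [Int.natAbs_mul, Int.natAbs_sign_of_ne_zero I.optimal.det_ne_zero, one_mul]
  refine (natAbs_sum_le (C := m * (2 ^ L * 2 ^ e) * 2 ^ L) Finset.univ _ fun j _ => ?_).trans ?_
  · rw [Int.natAbs_mul]
    exact Nat.mul_le_mul (h1 j) (hv j)
  · rw [Finset.card_fin]
    calc m * (m * (2 ^ L * 2 ^ e) * 2 ^ L) ≤ 2 ^ n * (2 ^ n * (2 ^ L * 2 ^ e) * 2 ^ L) := by gcongr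
      _ = 2 ^ (2 * n + 2 * L + e) := by ring

theorem natAbs_scaledShift_le :
    I.scaledShift.natAbs ≤ 2 ^ (2 * n + 2 * I.inputLength + detBits n I.inputLength) :=
  I.natAbs_sign_mul_dot_le _ I.natAbs_b_le

theorem natAbs_scaledCost_le (l : Fin I.d) :
    (I.scaledCost l).natAbs ≤ 2 ^ (2 * n + 2 * I.inputLength + detBits n I.inputLength + 1) := by
  unfold scaledCost
  refine (Int.natAbs_sub_le _ _).trans ?_
  have h1 := I.natAbs_sign_mul_dot_le (fun i => I.A i (I.col l)) fun i => I.natAbs_A_le i _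
  have h2 : (|(I.basisMatrix I.B I.card_B).det| * I.c (I.col l)).natAbs ≤
      2 ^ (2 * n + 2 * I.inputLength + detBits n I.inputLength) := by
    rw [Int.natAbs_mul, Int.natAbs_abs]
    refine (Nat.mul_le_mul I.natAbs_det_basisMatrix_le (I.natAbs_c_le _)).trans ?_
    rw [← pow_add]
    exact Nat.pow_le_pow_right Nat.two_pos (by omega)
  rw [pow_succ]
  omega

/-- Word size of the search in terms of the dimension and the input length. -/
def wordBits (n L : ℕ) : ℕ := 3 * n + 2 * L + 2 * detBits n L + 6

variable {I} in
theorem bits_magnitude_le (S : I.CyclicGenerators) :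
    bits (magnitude S) ≤ wordBits n I.inputLength := by
  set L := I.inputLength with hL
  set e := detBits n L with he
  have hk : S.k ≤ n := S.k_le.trans I.d_le_n
  have hd := I.d_le_n
  have hpow : ∀ {a : ℕ}, a ≤ 3 * n + 2 * L + 2 * e + 1 →
      2 ^ a ≤ 2 ^ (3 * n + 2 * L + 2 * e + 1) := fun h => Nat.pow_le_pow_right Nat.two_pos h
  have hn : n + 1 ≤ 2 ^ n := Nat.lt_two_pow_self
  have t1 : (S.k + 1) * (I.d + 1) ≤ 2 ^ (3 * n + 2 * L + 2 * e + 1) := by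
    refine le_trans ?_ (hpow (a := n + n) (by omega))
    rw [pow_add]
    exact Nat.mul_le_mul (by omega) (by omega)
  have t2 : 2 * I.rTop ≤ 2 ^ (3 * n + 2 * L + 2 * e + 1) := by
    refine le_trans ?_ (hpow (a := e + 1) (by omega))
    rw [pow_succ, mul_comm]
    exact Nat.mul_le_mul_right _ I.rTop_le
  have t3 : 2 ≤ 2 ^ (3 * n + 2 * L + 2 * e + 1) := hpow (a := 1) (by omega)
  have t4 : I.scaledShift.natAbs ≤ 2 ^ (3 * n + 2 * L + 2 * e + 1) :=
    I.natAbs_scaledShift_le.trans (hpow (by rw [← hL, ← he]; omega))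
  have t5 : ∑ l, (I.scaledCost l).natAbs * I.rTop ≤ 2 ^ (3 * n + 2 * L + 2 * e + 1) := by
    calc ∑ l, (I.scaledCost l).natAbs * I.rTop
        ≤ ∑ _l : Fin I.d, 2 ^ (2 * n + 2 * L + e + 1) * 2 ^ e :=
          Finset.sum_le_sum fun l _ => Nat.mul_le_mul (I.natAbs_scaledCost_le l) I.rTop_le
      _ = I.d * (2 ^ (2 * n + 2 * L + e + 1) * 2 ^ e) := by simp
      _ ≤ 2 ^ n * (2 ^ (2 * n + 2 * L + e + 1) * 2 ^ e) := Nat.mul_le_mul_right _ (by omega)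
      _ = 2 ^ (3 * n + 2 * L + 2 * e + 1) := by ring
  have hM : magnitude S ≤ 2 ^ (3 * n + 2 * L + 2 * e + 4) := by
    have e4 : 2 ^ (3 * n + 2 * L + 2 * e + 4) = 8 * 2 ^ (3 * n + 2 * L + 2 * e + 1) := by ring
    unfold magnitude
    omega
  refine (bits_le_bits (natCast_abs_le hM)).trans_eq ?_
  rw [bits_two_pow, wordBits]

end GroupRelaxation

end MCS

/-! ### Success probability and runtime -/

namespace MCS

namespace GroupRelaxation

variable {m n : ℕ} {I : GroupRelaxation m n} {S : I.CyclicGenerators} {xhat : I.Z} {isLazy : Bool}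
  {ε : ℝ}

theorem iter_roundKernel_one (T N : ℕ) (y : I.K) :
    Simulates.iter (roundKernel S xhat isLazy T) N y (fun _ => 1) = 1 := by
  induction N generalizing y with
  | zero => rfl
  | succ N ih =>
    have hP := pow_mem (chain_mem_rowStochastic S isLazy) T
    simp only [Simulates.iter, ih]
    unfold roundKernel kernelOf
    simp only [mul_one]
    rw [← ENNReal.ofReal_sum_of_nonneg fun y _ => nonneg_of_mem_rowStochastic hP,
      sum_row_of_mem_rowStochastic hP, ENNReal.ofReal_one]

theorem mem_KStar_of_le {y y' : I.K} (hy : y ∈ I.KStar xhat)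
    (h : scaledValue (xhat + (y' : I.Z)) ≤ scaledValue (xhat + (y : I.Z))) :
    y' ∈ I.KStar xhat :=
  fun x => ((I.scaledValue_le_iff _ _).1 h).trans (hy x)

theorem le_of_mem_KStar {y y' : I.K} (hy' : y' ∈ I.KStar xhat) :
    scaledValue (xhat + (y' : I.Z)) ≤ scaledValue (xhat + (y : I.Z)) :=
  (I.scaledValue_le_iff _ _).2 (hy' y)

/-- The iterate never leaves the set of minimizers. -/
theorem iter_roundKernel_of_mem (T N : ℕ) {y : I.K} (hy : y ∈ I.KStar xhat) :
    1 ≤ Simulates.iter (roundKernel S xhat isLazy T) N y ((I.KStar xhat).indicator 1) := by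
  induction N generalizing y with
  | zero =>
    simp only [Simulates.iter]
    rw [Set.indicator_of_mem hy]
    exact le_rfl
  | succ N ih =>
    have hP := pow_mem (chain_mem_rowStochastic S isLazy) T
    simp only [Simulates.iter]
    unfold roundKernel kernelOf
    calc (1 : ℝ≥0∞) = ∑ y', ENNReal.ofReal ((S.chain isLazy ^ T) y y') * 1 := by
          simp only [mul_one]
          rw [← ENNReal.ofReal_sum_of_nonneg fun y _ => nonneg_of_mem_rowStochastic hP,
            sum_row_of_mem_rowStochastic hP, ENNReal.ofReal_one]
      _ ≤ _ := by
          refine Finset.sum_le_sum fun y' _ => mul_le_mul_right (ih ?_) _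
          split_ifs with h
          · exact mem_KStar_of_le hy h
          · exact hy

/-- If every sample is a minimizer with probability at least `p`, whatever the current iterate is,
then `N` rounds fail with probability at most `(1 - p) ^ N`. -/
theorem le_iter_roundKernel {p : ℝ} (hp0 : 0 ≤ p) (hp1 : p ≤ 1) (T : ℕ)
    {s : Finset I.K} (hs : ∀ y, y ∈ s ↔ y ∈ I.KStar xhat)
    (hp : ∀ y, p ≤ ∑ y' ∈ s, (S.chain isLazy ^ T) y y') (N : ℕ) (y : I.K) :
    ENNReal.ofReal (1 - (1 - p) ^ N) ≤
      Simulates.iter (roundKernel S xhat isLazy T) N y ((I.KStar xhat).indicator 1) := by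
  induction N generalizing y with
  | zero => simp
  | succ N ih =>
    have hP := pow_mem (chain_mem_rowStochastic S isLazy) T
    have hP0 : ∀ y', 0 ≤ (S.chain isLazy ^ T) y y' := fun y' => nonneg_of_mem_rowStochastic hP
    set a : ℝ := 1 - (1 - p) ^ N with ha
    have hpN0 : 0 ≤ (1 - p) ^ N := pow_nonneg (by linarith) N
    have hpN1 : (1 - p) ^ N ≤ 1 := pow_le_one₀ (by linarith) (by linarith)
    have ha0 : 0 ≤ a := by linarith
    simp only [Simulates.iter]
    unfold roundKernel kernelOf
    calc ENNReal.ofReal (1 - (1 - p) ^ (N + 1))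
        ≤ ENNReal.ofReal (∑ y', (S.chain isLazy ^ T) y y' * (if y' ∈ s then 1 else a)) := by
          refine ENNReal.ofReal_le_ofReal ?_
          have e : ∀ y', (S.chain isLazy ^ T) y y' * (if y' ∈ s then 1 else a) =
              (if y' ∈ s then (S.chain isLazy ^ T) y y' else 0) * (1 - p) ^ N +
                (S.chain isLazy ^ T) y y' * a := fun y' => by
            split_ifs
            · rw [ha]; ring
            · ring
          simp only [e, Finset.sum_add_distrib, ← Finset.sum_mul, Finset.sum_ite_mem,
            Finset.univ_inter, sum_row_of_mem_rowStochastic hP, one_mul]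
          have := mul_le_mul_of_nonneg_right (hp y) hpN0
          rw [pow_succ, ha]
          linarith
      _ = ∑ y', ENNReal.ofReal ((S.chain isLazy ^ T) y y') *
            ENNReal.ofReal (if y' ∈ s then 1 else a) := by
          rw [ENNReal.ofReal_sum_of_nonneg]
          · exact Finset.sum_congr rfl fun y' _ => ENNReal.ofReal_mul (hP0 y')
          · exact fun y' _ => mul_nonneg (hP0 y') (by split_ifs <;> linarith)
      _ ≤ _ := by
          refine Finset.sum_le_sum fun y' _ => mul_le_mul_right ?_ _
          -- A sample in `K*` is always accepted; otherwise the induction hypothesis applies.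
          dsimp only
          by_cases h1 : y' ∈ s
          · have h2 := (hs y').1 h1
            rw [if_pos h1, if_pos (le_of_mem_KStar (y := y) h2), ENNReal.ofReal_one]
            exact iter_roundKernel_of_mem T N h2
          · rw [if_neg h1]
            exact ih _

theorem numSamples_le (hε : ε ≤ 1) (hε0 : 0 < ε) :
    (numSamples xhat ε : ℝ) ≤
      2 * ((Nat.card I.K : ℝ) / ((I.KStar xhat).ncard : ℝ)) * (1 + Real.log (1 / ε)) := by
  have hlog : 0 ≤ Real.log (1 / ε) := Real.log_nonneg (by
    rw [one_div]
    exact (one_le_inv₀ hε0).2 hε)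
  have hinv : (Nat.card I.K : ℝ) / ((I.KStar xhat).ncard : ℝ) = 1 / I.piStar xhat := by
    unfold piStar
    rw [one_div_div]
  have hpi := piStar_pos (I := I) xhat
  have h1 : 1 ≤ 1 / I.piStar xhat := by
    rw [le_div_iff₀ hpi, one_mul]
    exact piStar_le_one xhat
  have h2 : (⌊2 / I.piStar xhat * Real.log (1 / ε)⌋₊ : ℝ) ≤ 2 / I.piStar xhat * Real.log (1 / ε) :=
    Nat.floor_le (by positivity)
  have h3 : 2 / I.piStar xhat * Real.log (1 / ε) = 2 * (1 / I.piStar xhat) * Real.log (1 / ε) := by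
    ring
  unfold numSamples
  rw [hinv]
  push_cast
  linarith

theorem one_sub_pow_numSamples_le (hε0 : 0 < ε) :
    (1 - I.piStar xhat / 2) ^ numSamples xhat ε ≤ ε := by
  have hpi := piStar_pos (I := I) xhat
  have hpi1 := piStar_le_one (I := I) xhat
  have h1 : 2 / I.piStar xhat * Real.log (1 / ε) ≤ numSamples xhat ε := by
    unfold numSamples
    push_cast
    exact (Nat.lt_floor_add_one _).le
  have h2 : Real.log (1 / ε) ≤ numSamples xhat ε * (I.piStar xhat / 2) := by
    calc Real.log (1 / ε) = 2 / I.piStar xhat * Real.log (1 / ε) * (I.piStar xhat / 2) := by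
          field_simp
      _ ≤ _ := mul_le_mul_of_nonneg_right h1 (by positivity)
  calc (1 - I.piStar xhat / 2) ^ numSamples xhat ε
      ≤ Real.exp (-(I.piStar xhat / 2)) ^ numSamples xhat ε :=
        pow_le_pow_left₀ (by linarith) (by linarith [Real.add_one_le_exp (-(I.piStar xhat / 2))]) _
    _ = Real.exp (-(numSamples xhat ε * (I.piStar xhat / 2))) := by
        rw [← Real.exp_nat_mul, mul_neg]
    _ ≤ Real.exp (Real.log ε) := by
        rw [one_div, Real.log_inv] at h2
        exact Real.exp_le_exp.2 (by linarith)
    _ = ε := Real.exp_log hε0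

theorem output_eq {s₀ s : Mem} {z w : I.Z} (h : Represents s₀ z w s) :
    I.output s = fun l => ((z l).val : ℤ) :=
  funext h.iterate

/-- The success probability: each round hits `K*` with probability at least
`π* - π* / 2 = π* / 2` from every starting point, by the choice of the mixing time. -/
theorem search_success (hx : I.IsFeasible xhat) (hε0 : 0 < ε)
    (hmix : tMix S xhat isLazy ≠ ⊤) :
    ENNReal.ofReal (1 - ε) ≤
      (search S xhat isLazy ε).toOuterMeasure {o | I.Solves (I.output o.1)} := by
  classical
  have hpi := piStar_pos (I := I) xhat
  have hpi1 := piStar_le_one (I := I) xhat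
  have hs : ∀ y, y ∈ (I.KStar xhat).toFinset ↔ y ∈ I.KStar xhat := fun y => Set.mem_toFinset
  have hp : ∀ y, I.piStar xhat / 2 ≤ ∑ y' ∈ (I.KStar xhat).toFinset,
      (S.chain isLazy ^ (tMix S xhat isLazy).toNat) y y' := fun y => by
    have h := sum_uniform_sub_le_sum_row (chain_mem_rowStochastic S isLazy)
      (distToStationary_toNat_mixingTime hmix) y (I.KStar xhat).toFinset
    have h1 : ((I.KStar xhat).toFinset.card : ℝ) / Fintype.card I.K = I.piStar xhat := by
      unfold piStar
      rw [Set.ncard_eq_toFinset_card', Nat.card_eq_fintype_card]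
    rw [h1] at h
    unfold tMix
    linarith
  calc ENNReal.ofReal (1 - ε)
      ≤ ENNReal.ofReal (1 - (1 - I.piStar xhat / 2) ^ numSamples xhat ε) :=
        ENNReal.ofReal_le_ofReal (by linarith [one_sub_pow_numSamples_le (xhat := xhat) hε0])
    _ ≤ _ := le_iter_roundKernel (by linarith) (by linarith) _ hs hp (numSamples xhat ε) 0
    _ ≤ expect (search S xhat isLazy ε) (Set.indicator {o | I.Solves (I.output o.1)} 1) := by
        refine mcs_simulates _ _ ?_
        rintro y o ⟨w, hw⟩ -
        by_cases hy : y ∈ I.KStar xhat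
        · rw [Set.indicator_of_mem hy, Set.indicator_of_mem]
          · exact le_rfl
          · rw [Set.mem_ofPred_eq, output_eq hw]
            exact solves_of_mem_KStar hx hy
        · rw [Set.indicator_of_notMem hy]
          exact zero_le
    _ = _ := expect_indicator _ _

theorem roundCost_mono {d d' β β' T T' : ℕ} (hd : d ≤ d') (hβ : β ≤ β') (hT : T ≤ T') :
    roundCost d β T ≤ roundCost d' β' T' := by
  unfold roundCost stepCost
  gcongr

theorem search_cost {P : ℕ} (hε0 : 0 < ε) (hε1 : ε ≤ 1) (hmix : tMix S xhat isLazy ≤ (P : ℕ∞)) :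
    ∀ o ∈ (search S xhat isLazy ε).support,
      (o.2 : ℝ) ≤ ((Nat.card I.K : ℝ) / ((I.KStar xhat).ncard : ℝ)) *
        ((2 * (roundCost n (wordBits n I.inputLength) P + 5) : ℕ) : ℝ) *
        (1 + Real.log (1 / ε)) := by
  intro o ho
  have h1 := ((mcs_simulates.ensures (iter_roundKernel_one _ _ _).ge) o ho).2
  have hT : (tMix S xhat isLazy).toNat ≤ P := ENat.toNat_le_of_le_natCast hmix
  have h2 : o.2 ≤ numSamples xhat ε * (roundCost n (wordBits n I.inputLength) P + 5) :=
    h1.trans (Nat.mul_le_mul_left _ (Nat.add_le_add_right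
      (roundCost_mono I.d_le_n (bits_magnitude_le S) hT) 5))
  generalize roundCost n (wordBits n I.inputLength) P + 5 = c at h2 ⊢
  calc (o.2 : ℝ) ≤ (numSamples xhat ε : ℝ) * (c : ℝ) := by exact_mod_cast h2
    _ ≤ 2 * ((Nat.card I.K : ℝ) / ((I.KStar xhat).ncard : ℝ)) * (1 + Real.log (1 / ε)) * (c : ℝ) :=
        mul_le_mul_of_nonneg_right (numSamples_le hε1 hε0) (Nat.cast_nonneg c)
    _ = _ := by
        push_cast
        ring

open MvPolynomial in
/-- The polynomial behind the runtime bound. -/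
noncomputable def runtimePolynomial (p : MvPolynomial (Fin 2) ℕ) : MvPolynomial (Fin 2) ℕ :=
  let β := 3 * X 0 + 2 * X 1 + 2 * (X 0 ^ 2 + X 0 * X 1) + 6
  2 * (2 * (X 0 * (11 * β + 1) + 4 * β) +
    p * ((21 * β + β * β + X 0 * (23 * β + 3 * (β * β) + 1)) + 1) + 2 * (p + 1) +
    2 * (X 0 * (15 * β + β * β + 1) + 6 * β) + 4 * β + 5)

theorem eval_runtimePolynomial (p : MvPolynomial (Fin 2) ℕ) (n L : ℕ) :
    MvPolynomial.eval ![n, L] (runtimePolynomial p) =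
      2 * (roundCost n (wordBits n L) (MvPolynomial.eval ![n, L] p) + 5) := by
  simp [runtimePolynomial, roundCost, stepCost, wordBits, detBits]

end GroupRelaxation

end MCS

theorem theorem3p4 :
    (∀ p : MvPolynomial (Fin 2) ℕ, ∃ q : MvPolynomial (Fin 2) ℕ,
      ∀ (m n : ℕ) (I : MCS.GroupRelaxation m n) (S : I.CyclicGenerators) (xhat : I.Z)
        (isLazy : Bool) (ε : ℝ),
        I.IsFeasible xhat → 0 < ε → ε < 1 →
        MCS.GroupRelaxation.tMix S xhat isLazy
          ≤ ((MvPolynomial.eval ![n, I.inputLength] p : ℕ) : ℕ∞) →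
        ENNReal.ofReal (1 - ε) ≤
            (MCS.GroupRelaxation.search S xhat isLazy ε).toOuterMeasure
              {o | I.Solves (I.output o.1)} ∧
          ∀ o ∈ (MCS.GroupRelaxation.search S xhat isLazy ε).support,
            (o.2 : ℝ) ≤
              ((Nat.card I.K : ℝ) / ((I.KStar xhat).ncard : ℝ)) *
                ((MvPolynomial.eval ![n, I.inputLength] q : ℕ) : ℝ) *
                (1 + Real.log (1 / ε))) ∧
    (∃ s : MvPolynomial (Fin 3) ℕ,
      ∀ (m n : ℕ) (I : MCS.GroupRelaxation m n) (S : I.CyclicGenerators) (xhat : I.Z) (u : ℕ),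
        (∀ j, addOrderOf (S.h j) ≤ u) →
        MCS.GroupRelaxation.tMix S xhat true
          ≤ ((MvPolynomial.eval ![n, I.inputLength, u] s : ℕ) : ℕ∞)) := by
  refine ⟨fun p => ⟨MCS.GroupRelaxation.runtimePolynomial p, ?_⟩,
    ⟨8 * MvPolynomial.X 0 ^ 2 * MvPolynomial.X 2 ^ 3, ?_⟩⟩
  · intro m n I S xhat isLazy ε hx hε0 hε1 hmix
    refine ⟨MCS.GroupRelaxation.search_success hx hε0
      (ne_top_of_le_ne_top (ENat.natCast_ne_top _) hmix), ?_⟩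
    rw [MCS.GroupRelaxation.eval_runtimePolynomial]
    exact MCS.GroupRelaxation.search_cost hε0 hε1.le hmix
  · intro m n I S xhat u hu
    refine (S.tMix_lazy_le hu xhat).trans ?_
    have hk : S.k ≤ n := S.k_le.trans I.d_le_n
    have : 8 * S.k ^ 2 * u ^ 3 ≤ 8 * n ^ 2 * u ^ 3 := by gcongr
    have hcast : ((8 * S.k ^ 2 * u ^ 3 : ℕ) : ℕ∞) ≤ (8 * n ^ 2 * u ^ 3 : ℕ) := by
      exact_mod_cast this
    simpa using hcast
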